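/- Let $\sigma,\lambda,T>0$ and $r\in\mathbb R$, and let $\widehat g(\xi)=\int_{\mathbb R}e^{-i\xi v}g(v)\,dv$ for $g\in L^1(\mathbb R)$. Such a $g$ is said to belong to the homogeneous Sobolev space $\dot H_r(\mathbb R)$ if $\int_{\mathbb R}|\xi|^{2r}|\widehat g(\xi)|^2\,d\xi<\infty$. Consider on the whole line the Fokker--Planck equation $$\frac{\partial f}{\partial t}=\frac{\sigma}{2}\frac{\partial^2}{\partial v^2}\left(v^2f\right)+\lambda\frac{\partial}{\partial v}\left((v-1)f\right),\qquad v\in\mathbb R,\ 0\le t\le T,\qquad f(\cdot,0)=f_0 .$$ A solution is a function $f$ with $f\in L^\infty([0,T],L^1\cap L^\infty(\mathbb R))$ and $v\,\partial_vf\in L^2([0,T],L^2(\mathbb R))$ (distributional derivative) such that, for every $\varphi\in C_c^\infty(\mathbb R)$ and every $t\in[0,T]$, $$\int_{\mathbb R}\varphi(v) f(v,t)\,dv=\int_{\mathbb R}\varphi(v) f_0(v)\,dv+\int_0^t\int_{\mathbb R}\left[\frac{\sigma}{2}v^2\varphi''(v)-\lambda(v-1)\varphi'(v)\right]f(v,s)\,dv\,ds$$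 (the $L^1$ and $L^\infty$ bounds being understood for every $t\in[0,T]$). Let $f_0$ be a probability density on $\mathbb R$ that belongs to $\dot H_r(\mathbb R)$, and let $f$ be the solution with initial value $f_0$. Then for every $t\in[0,T]$ the function $f(\cdot,t)$ belongs to $\dot H_r(\mathbb R)$, and $$\int_{\mathbb R}|\xi|^{2r}\,|\widehat f(\xi,t)|^2\,d\xi\ \le\ \exp\left\{\frac{2r+1}{2}\left[\sigma\,\frac{2r+3}{2}+2\lambda\right]t\right\}\int_{\mathbb R}|\xi|^{2r}\,|\widehat f_0(\xi)|^2\,d\xi .$$ -/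

import Mathlib

open MeasureTheory Set
open scoped ENNReal NNReal

noncomputable section

namespace WealthFP

/-- A probability density on the real line. -/
structure IsProbabilityDensity (f₀ : ℝ → ℝ) : Prop where
  integrable : Integrable f₀ volume
  nonneg : ∀ᵐ v ∂volume, 0 ≤ f₀ v
  integral_eq_one : ∫ v, f₀ v = 1

/-- The Fourier transform `∫ e^{-iξv} g(v) dv` (no factor `2π`) of an integrable function. -/
def fourierHat (g : ℝ → ℝ) (ξ : ℝ) : ℂ :=
  ∫ v : ℝ, Complex.exp (-(Complex.I * (ξ : ℂ) * (v : ℂ))) * (g v : ℂ)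

/-- The quantity `∫ |ξ|^{2r} |ĝ(ξ)|² dξ ∈ [0, ∞]`. -/
def sobolevNorm (r : ℝ) (g : ℝ → ℝ) : ℝ≥0∞ :=
  ∫⁻ ξ : ℝ, ENNReal.ofReal (|ξ| ^ (2 * r) * ‖fourierHat g ξ‖ ^ 2)

/-- Membership of an integrable function in the homogeneous Sobolev space `Ḣ_r(ℝ)`. -/
def MemSobolev (r : ℝ) (g : ℝ → ℝ) : Prop :=
  Integrable g volume ∧ sobolevNorm r g < (⊤ : ℝ≥0∞)

/-- Test functions: real valued, smooth and compactly supported. -/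
def IsTestFunction (φ : ℝ → ℝ) : Prop :=
  ContDiff ℝ (⊤ : ℕ∞) φ ∧ HasCompactSupport φ

/-- The adjoint Fokker-Planck operator `(σ/2) v² φ'' - lam (v - 1) φ'`. -/
def adjointOperator (σ lam : ℝ) (φ : ℝ → ℝ) (v : ℝ) : ℝ :=
  σ / 2 * v ^ 2 * deriv (deriv φ) v - lam * (v - 1) * deriv φ v

/-- `g` is `v ∂f/∂v` in the sense of distributions on the real line:
`∫ g φ = - ∫ f (v φ)'` for every test function `φ`. -/
def IsWeightedWeakDeriv (f g : ℝ → ℝ) : Prop :=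
  ∀ φ : ℝ → ℝ, IsTestFunction φ →
    ∫ v, g v * φ v = -∫ v, f v * deriv (fun w : ℝ => w * φ w) v

/-- `f` (written `f t v`) is a solution on `[0, T]` of
`∂f/∂t = (σ/2) ∂²(v² f)/∂v² + lam ∂((v - 1) f)/∂v`, `f(·, 0) = f₀`, posed on the whole line, in the
class `f ∈ L^∞([0,T], L¹ ∩ L^∞)`, `v ∂f/∂v ∈ L²([0,T], L²)`.
The equation and the initial condition are imposed in the weak form, integrated in time. -/
structure IsSolution (σ lam T : ℝ) (f₀ : ℝ → ℝ) (f : ℝ → ℝ → ℝ) : Prop where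
  aestronglyMeasurable :
    AEStronglyMeasurable (Function.uncurry f) ((volume.restrict (Icc 0 T)).prod volume)
  aestronglyMeasurable_slice : ∀ t ∈ Icc 0 T, AEStronglyMeasurable (f t) volume
  bounded : ∃ M : ℝ≥0, ∀ t ∈ Icc 0 T,
    eLpNorm (f t) 1 volume ≤ M ∧ eLpNorm (f t) (⊤ : ℝ≥0∞) volume ≤ M
  weighted_deriv : ∃ g : ℝ → ℝ → ℝ,
    MemLp (Function.uncurry g) 2 ((volume.restrict (Icc 0 T)).prod volume) ∧
      ∀ᵐ t ∂(volume.restrict (Icc 0 T)), IsWeightedWeakDeriv (f t) (g t)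
  weak_form : ∀ φ : ℝ → ℝ, IsTestFunction φ → ∀ t ∈ Icc 0 T,
    ∫ v, φ v * f t v =
      (∫ v, φ v * f₀ v) + ∫ s in (0 : ℝ)..t, ∫ v, adjointOperator σ lam φ v * f s v

end WealthFP

end

/-!
The equation is the forward equation of the diffusion `dX = lam (1 - X) dt + √σ X dW`. Conditionally
on the noise, `X_t` is an affine image `A X_0 + B` of the initial value, where `log A` is Gaussian
with mean `-(lam + σ / 2) t` and variance `σ t`. On the Fourier side,
`f̂(ξ, t) = E [exp (-i ξ B) f̂₀ (A ξ)]`; the shift `B` only contributes a phase, and the rescaling by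
`A` multiplies the `L²` norm with weight `|ξ| ^ (2 r)` by `A ^ (-p)` with `p = r + 1 / 2`. Hence the
norm grows at most by the factor `E [A ^ (-p)] = exp (p (lam + σ (p + 1) / 2) t)`, whose square is
the constant of the statement.

To avoid stochastic calculus, the noise is replaced by coin tosses: in a time step `h²` the value
`X` moves to `A X + lam h²`, where `A = exp (± √σ h - (lam + σ / 2) h²)` with equal probabilities
(`densityStep`, and `observableStep` for the dual action on test functions). Since
`cosh x ≤ exp (x² / 2)`, the moment `E [A ^ (-p)]` of a coin toss is at most that of the diffusion,
so that the estimate with its exact constant already holds for the recursion, for every `h`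
(`sobolevNorm_densityStep_le`).

It remains to see that the recursion converges to any given solution. A test function `u` is
measured by the bounds `|u^(k)| ≤ K`, `|v|^k |u^(k)| ≤ K` for `k ≤ 4` (`EulerBound`). One step
propagates them with a factor `exp (c h²)` (`EulerBound.observableStep`) and agrees with
`u + h² L u` up to `O(h³)`, where `L` is `adjointOperator` (`exists_abs_observableStep_sub_le`);
the weak form, used twice, shows the same for the solution. So the recursion converges to the solution
against test functions (`IsSolution.tendsto_integral_approxDensity`). The solution has mass one
(`IsSolution.integral_eq_one`), thus no mass escapes, the Fourier transforms converge pointwise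
(`tendsto_fourierHat_of_tendsto_integral`), and Fatou's lemma carries the estimate to the limit.
-/

noncomputable section

namespace WealthFP

/-! ### Affine images of densities -/

/-- The density of `a X + b` when `X` has density `g`, for `a > 0`. -/
def affinePush (a b : ℝ) (g : ℝ → ℝ) (v : ℝ) : ℝ := a⁻¹ * g (a⁻¹ * (v - b))

theorem integrable_affinePush {a : ℝ} (ha : 0 < a) (b : ℝ) {g : ℝ → ℝ} (hg : Integrable g) :
    Integrable (affinePush a b g) := by
  have h1 := (hg.comp_mul_left' (inv_ne_zero ha.ne')).comp_sub_right b
  exact h1.const_mul a⁻¹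

theorem integral_comp_mul_add_const {E : Type*} [NormedAddCommGroup E] [NormedSpace ℝ E]
    {a : ℝ} (ha : 0 < a) (b : ℝ) (F : ℝ → E) :
    ∫ v, F (a * v + b) = a⁻¹ • ∫ v, F v := by
  rw [Measure.integral_comp_mul_left (fun w => F (w + b)) a, integral_add_right_eq_self F b,
    abs_of_pos (inv_pos.2 ha)]

theorem integral_smul_affinePush {E : Type*} [NormedAddCommGroup E] [NormedSpace ℝ E]
    {a : ℝ} (ha : 0 < a) (b : ℝ) (g : ℝ → ℝ) (c : ℝ → E) :
    ∫ v, affinePush a b g v • c v = ∫ v, g v • c (a * v + b) := by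
  have h := integral_comp_mul_add_const ha b (fun v => g (a⁻¹ * (v - b)) • c v)
  have e : ∀ v, a⁻¹ * (a * v + b - b) = v := fun v => by field_simp; ring
  simp only [e] at h
  rw [h, ← integral_smul]
  simp [affinePush, mul_smul]

theorem affinePush_nonneg_ae {a : ℝ} (ha : 0 < a) (b : ℝ) {g : ℝ → ℝ}
    (hg : ∀ᵐ v ∂volume, 0 ≤ g v) : ∀ᵐ v ∂volume, 0 ≤ affinePush a b g v := by
  have hq : Measure.QuasiMeasurePreserving (fun v : ℝ => a⁻¹ * (v - b)) volume volume := by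
    have h1 : Measure.QuasiMeasurePreserving (fun v : ℝ => a⁻¹ * v) volume volume := by
      refine ⟨by fun_prop, ?_⟩
      rw [Real.map_volume_mul_left (inv_ne_zero ha.ne')]
      exact Measure.smul_absolutelyContinuous
    exact h1.comp (measurePreserving_sub_right volume b).quasiMeasurePreserving
  filter_upwards [hq.ae hg] with v hv
  exact mul_nonneg (inv_pos.2 ha).le hv

/-! ### The Fourier transform and the Sobolev functional -/

theorem norm_cexp_neg_I_mul (ξ v : ℝ) :
    ‖Complex.exp (-(Complex.I * (ξ : ℂ) * (v : ℂ)))‖ = 1 := by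
  rw [Complex.norm_exp]; simp

theorem continuous_fourierHat {g : ℝ → ℝ} (hg : Integrable g) : Continuous (fourierHat g) := by
  unfold fourierHat
  refine continuous_of_dominated (bound := fun v => ‖g v‖) (fun ξ => ?_) (fun ξ => ?_) hg.norm ?_
  · exact (Continuous.aestronglyMeasurable (by fun_prop)).mul
      (Complex.continuous_ofReal.comp_aestronglyMeasurable hg.1)
  · refine Filter.Eventually.of_forall fun v => ?_
    rw [norm_mul, norm_cexp_neg_I_mul, one_mul, Complex.norm_real]
  · exact Filter.Eventually.of_forall fun v => by fun_prop

theorem fourierHat_affinePush {a : ℝ} (ha : 0 < a) (b : ℝ) (g : ℝ → ℝ) (ξ : ℝ) :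
    fourierHat (affinePush a b g) ξ =
      Complex.exp (-(Complex.I * (ξ : ℂ) * (b : ℂ))) * fourierHat g (a * ξ) := by
  have h := integral_smul_affinePush ha b g
    (fun v : ℝ => Complex.exp (-(Complex.I * (ξ : ℂ) * (v : ℂ))))
  unfold fourierHat
  rw [← integral_const_mul]
  simp only [Complex.real_smul, mul_comm (Complex.ofReal _) (Complex.exp _)] at h
  rw [h]
  congr 1
  ext v
  rw [← mul_assoc, ← Complex.exp_add]
  congr 2
  push_cast
  ring

theorem lintegral_comp_mul_left_of_pos {a : ℝ} (ha : 0 < a) {F : ℝ → ℝ≥0∞} :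
    ∫⁻ ξ, F (a * ξ) = ENNReal.ofReal a⁻¹ * ∫⁻ ξ, F ξ := by
  have h := (Homeomorph.mulLeft₀ a ha.ne').measurableEmbedding.lintegral_map F (μ := volume)
  simp only [Homeomorph.coe_mulLeft₀] at h
  rw [← h, Real.map_volume_mul_left ha.ne', lintegral_smul_measure, smul_eq_mul,
    abs_of_pos (inv_pos.2 ha)]

theorem lintegral_weight_fourierHat_comp_mul {a : ℝ} (ha : 0 < a) (r : ℝ) (g : ℝ → ℝ) :
    ∫⁻ ξ : ℝ, ENNReal.ofReal (|ξ| ^ (2 * r) * ‖fourierHat g (a * ξ)‖ ^ 2) =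
      ENNReal.ofReal (a ^ (-(2 * r + 1))) * sobolevNorm r g := by
  have e : ∀ ξ : ℝ, ENNReal.ofReal (|ξ| ^ (2 * r) * ‖fourierHat g (a * ξ)‖ ^ 2) =
      ENNReal.ofReal (a ^ (-(2 * r))) *
        ENNReal.ofReal (|a * ξ| ^ (2 * r) * ‖fourierHat g (a * ξ)‖ ^ 2) := by
    intro ξ
    rw [← ENNReal.ofReal_mul (by positivity), abs_mul, abs_of_pos ha,
      Real.mul_rpow ha.le (abs_nonneg ξ), Real.rpow_neg ha.le]
    congr 1
    have : a ^ (2 * r) ≠ 0 := (Real.rpow_pos_of_pos ha _).ne'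
    field_simp
  simp_rw [e]
  rw [lintegral_const_mul' _ _ ENNReal.ofReal_ne_top,
    lintegral_comp_mul_left_of_pos ha
      (F := fun ξ => ENNReal.ofReal (|ξ| ^ (2 * r) * ‖fourierHat g ξ‖ ^ 2)),
    ← mul_assoc, ← ENNReal.ofReal_mul (by positivity), sobolevNorm]
  congr 2
  rw [neg_add, Real.rpow_add ha, Real.rpow_neg_one]

/-! ### The discrete random affine step -/

/-- The random multiplier of one step of length `h ^ 2`, on the event that the Bernoulli noise is
`+1`; replacing `h` by `-h` gives its value when the noise is `-1`. -/
def stepFactor (σ lam h : ℝ) : ℝ := Real.exp (√σ * h - (lam + σ / 2) * h ^ 2)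

/-- The density after one step `X ↦ A X + lam h²`, where `A` takes the values
`stepFactor σ lam (± h)` with probability `1 / 2` each, independently of `X`. -/
def densityStep (σ lam h : ℝ) (g : ℝ → ℝ) (v : ℝ) : ℝ :=
  (affinePush (stepFactor σ lam h) (lam * h ^ 2) g v +
    affinePush (stepFactor σ lam (-h)) (lam * h ^ 2) g v) / 2

/-- The operator dual to `densityStep`: the conditional expectation of an observable after one
step. -/
def observableStep (σ lam h : ℝ) (u : ℝ → ℝ) (v : ℝ) : ℝ :=
  (u (stepFactor σ lam h * v + lam * h ^ 2) + u (stepFactor σ lam (-h) * v + lam * h ^ 2)) / 2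

theorem stepFactor_pos (σ lam h : ℝ) : 0 < stepFactor σ lam h := Real.exp_pos _

theorem integrable_densityStep (σ lam h : ℝ) {g : ℝ → ℝ} (hg : Integrable g) :
    Integrable (densityStep σ lam h g) :=
  ((integrable_affinePush (stepFactor_pos _ _ _) _ hg).add
    (integrable_affinePush (stepFactor_pos _ _ _) _ hg)).div_const 2

theorem integrable_mul_of_abs_le {g φ : ℝ → ℝ} (hg : Integrable g) (hφ : Continuous φ)
    {C : ℝ} (hC : ∀ v, |φ v| ≤ C) : Integrable (fun v => φ v * g v) :=
  hg.bdd_mul hφ.aestronglyMeasurable (Filter.Eventually.of_forall hC)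

theorem integral_mul_densityStep (σ lam h : ℝ) {g φ : ℝ → ℝ} (hg : Integrable g)
    (hφ : Continuous φ) {C : ℝ} (hC : ∀ v, |φ v| ≤ C) :
    ∫ v, φ v * densityStep σ lam h g v = ∫ v, observableStep σ lam h φ v * g v := by
  have key : ∀ a : ℝ, 0 < a → ∀ b, ∫ v, φ v * affinePush a b g v = ∫ v, φ (a * v + b) * g v := by
    intro a ha b
    have h := integral_smul_affinePush ha b g φ
    simpa only [smul_eq_mul, mul_comm] using h
  have int1 : ∀ a : ℝ, 0 < a → ∀ b, Integrable fun v => φ v * affinePush a b g v :=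
    fun a ha b => integrable_mul_of_abs_le (integrable_affinePush ha b hg) hφ hC
  have int2 : ∀ a b : ℝ, Integrable fun v => φ (a * v + b) * g v := fun a b =>
    integrable_mul_of_abs_le hg (φ := fun v => φ (a * v + b)) (by fun_prop)
      (fun v => hC _)
  have e1 : ∀ v, φ v * densityStep σ lam h g v =
      (φ v * affinePush (stepFactor σ lam h) (lam * h ^ 2) g v +
        φ v * affinePush (stepFactor σ lam (-h)) (lam * h ^ 2) g v) / 2 := fun v => by
    unfold densityStep; ring
  have e2 : ∀ v, observableStep σ lam h φ v * g v =
      (φ (stepFactor σ lam h * v + lam * h ^ 2) * g v +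
        φ (stepFactor σ lam (-h) * v + lam * h ^ 2) * g v) / 2 := fun v => by
    unfold observableStep; ring
  simp_rw [e1, e2]
  rw [integral_div, integral_div, integral_add (int1 _ (stepFactor_pos _ _ _) _)
    (int1 _ (stepFactor_pos _ _ _) _), integral_add (int2 _ _) (int2 _ _),
    key _ (stepFactor_pos _ _ _), key _ (stepFactor_pos _ _ _)]

theorem IsProbabilityDensity.densityStep (σ lam h : ℝ) {g : ℝ → ℝ}
    (hg : IsProbabilityDensity g) : IsProbabilityDensity (densityStep σ lam h g) where
  integrable := integrable_densityStep σ lam h hg.integrable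
  nonneg := by
    filter_upwards [affinePush_nonneg_ae (stepFactor_pos σ lam h) (lam * h ^ 2) hg.nonneg,
      affinePush_nonneg_ae (stepFactor_pos σ lam (-h)) (lam * h ^ 2) hg.nonneg] with v h1 h2
    exact div_nonneg (add_nonneg h1 h2) zero_le_two
  integral_eq_one := by
    have h1 := integral_mul_densityStep σ lam h hg.integrable
      (φ := fun _ => 1) continuous_const (C := 1) (fun _ => by simp)
    simpa [observableStep, hg.integral_eq_one] using h1

theorem fourierHat_densityStep (σ lam h : ℝ) {g : ℝ → ℝ} (hg : Integrable g) (ξ : ℝ) :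
    fourierHat (densityStep σ lam h g) ξ =
      Complex.exp (-(Complex.I * (ξ : ℂ) * ((lam * h ^ 2 : ℝ) : ℂ))) *
        ((fourierHat g (stepFactor σ lam h * ξ) + fourierHat g (stepFactor σ lam (-h) * ξ)) / 2) := by
  have int : ∀ a : ℝ, 0 < a → ∀ b, Integrable fun v : ℝ =>
      Complex.exp (-(Complex.I * (ξ : ℂ) * (v : ℂ))) * (affinePush a b g v : ℂ) := by
    intro a ha b
    refine (integrable_affinePush ha b hg).ofReal.bdd_mul
      (Continuous.aestronglyMeasurable (by fun_prop)) (c := 1)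
      (Filter.Eventually.of_forall fun v => (norm_cexp_neg_I_mul ξ v).le)
  have e : fourierHat (densityStep σ lam h g) ξ =
      (fourierHat (affinePush (stepFactor σ lam h) (lam * h ^ 2) g) ξ +
        fourierHat (affinePush (stepFactor σ lam (-h)) (lam * h ^ 2) g) ξ) / 2 := by
    unfold fourierHat
    rw [← integral_add (int _ (stepFactor_pos _ _ _) _) (int _ (stepFactor_pos _ _ _) _),
      ← integral_div]
    congr 1
    ext v
    simp only [densityStep]
    push_cast
    ring
  rw [e, fourierHat_affinePush (stepFactor_pos _ _ _), fourierHat_affinePush (stepFactor_pos _ _ _)]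
  ring

/-- The moment of order `-p` of the random multiplier is
`exp (p (lam + σ / 2) h²) cosh (p √σ h)`. -/
theorem mean_stepFactor_rpow_neg_le {σ : ℝ} (hσ : 0 ≤ σ) (lam h p : ℝ) :
    (stepFactor σ lam h ^ (-p) + stepFactor σ lam (-h) ^ (-p)) / 2 ≤
      Real.exp (p * (lam + σ * (p + 1) / 2) * h ^ 2) := by
  have e : (stepFactor σ lam h ^ (-p) + stepFactor σ lam (-h) ^ (-p)) / 2 =
      Real.exp (p * (lam + σ / 2) * h ^ 2) * Real.cosh (p * √σ * h) := by
    unfold stepFactor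
    rw [← Real.exp_mul, ← Real.exp_mul, Real.cosh_eq, mul_div_assoc', mul_add, ← Real.exp_add,
      ← Real.exp_add, add_comm]
    congr 3 <;> ring_nf
  rw [e]
  calc _ ≤ Real.exp (p * (lam + σ / 2) * h ^ 2) * Real.exp ((p * √σ * h) ^ 2 / 2) :=
        mul_le_mul_of_nonneg_left (Real.cosh_le_exp_half_sq _) (Real.exp_pos _).le
    _ = _ := by
        rw [← Real.exp_add, mul_pow, mul_pow, Real.sq_sqrt hσ]
        ring_nf

/-- Cauchy-Schwarz with the weights `stepFactor ^ (± p)`, `p = r + 1 / 2`, makes the rescalings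
of frequency cost exactly the square of the moment of order `-p`. -/
theorem sobolevNorm_densityStep_le {σ : ℝ} (hσ : 0 ≤ σ) (lam h r : ℝ) {g : ℝ → ℝ}
    (hg : Integrable g) :
    sobolevNorm r (densityStep σ lam h g) ≤
      ENNReal.ofReal
        (Real.exp ((2 * r + 1) / 2 * (σ * ((2 * r + 3) / 2) + 2 * lam) * h ^ 2)) *
        sobolevNorm r g := by
  set p : ℝ := r + 1 / 2 with hp
  set α := stepFactor σ lam h with hα
  set β := stepFactor σ lam (-h) with hβ
  have hα0 : 0 < α := stepFactor_pos _ _ _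
  have hβ0 : 0 < β := stepFactor_pos _ _ _
  set m : ℝ := (α ^ (-p) + β ^ (-p)) / 2 with hm
  have hm0 : 0 ≤ m := by positivity
  have hc := continuous_fourierHat hg
  have pw : ∀ ξ : ℝ, ENNReal.ofReal (|ξ| ^ (2 * r) * ‖fourierHat (densityStep σ lam h g) ξ‖ ^ 2) ≤
      ENNReal.ofReal (m / 2) *
        (ENNReal.ofReal (α ^ p) *
          ENNReal.ofReal (|ξ| ^ (2 * r) * ‖fourierHat g (α * ξ)‖ ^ 2) +
        ENNReal.ofReal (β ^ p) *
          ENNReal.ofReal (|ξ| ^ (2 * r) * ‖fourierHat g (β * ξ)‖ ^ 2)) := by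
    intro ξ
    rw [← ENNReal.ofReal_mul (by positivity), ← ENNReal.ofReal_mul (by positivity),
      ← ENNReal.ofReal_add (by positivity) (by positivity), ← ENNReal.ofReal_mul (by positivity)]
    apply ENNReal.ofReal_le_ofReal
    rw [fourierHat_densityStep σ lam h hg, norm_mul, norm_cexp_neg_I_mul, one_mul, norm_div]
    set x := ‖fourierHat g (α * ξ)‖
    set y := ‖fourierHat g (β * ξ)‖
    have htri : ‖fourierHat g (α * ξ) + fourierHat g (β * ξ)‖ ≤ x + y := norm_add_le _ _
    have hw : 0 ≤ |ξ| ^ (2 * r) := by positivity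
    have hsq : (‖fourierHat g (α * ξ) + fourierHat g (β * ξ)‖ / ‖(2 : ℂ)‖) ^ 2 ≤
        ((x + y) / 2) ^ 2 := by
      rw [Complex.norm_ofNat]
      gcongr
    have hA : α ^ (-p) * α ^ p = 1 := by rw [← Real.rpow_add hα0]; simp
    have hB : β ^ (-p) * β ^ p = 1 := by rw [← Real.rpow_add hβ0]; simp
    have hA0 := Real.rpow_pos_of_pos hα0 p
    have hB0 := Real.rpow_pos_of_pos hβ0 p
    have hA1 := Real.rpow_pos_of_pos hα0 (-p)
    have hB1 := Real.rpow_pos_of_pos hβ0 (-p)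
    have cs : ((x + y) / 2) ^ 2 ≤ m / 2 * (α ^ p * x ^ 2 + β ^ p * y ^ 2) := by
      have h1 : 0 ≤ α ^ (-p) * β ^ (-p) * (α ^ p * x - β ^ p * y) ^ 2 := by positivity
      have h2 : α ^ (-p) * β ^ (-p) * (α ^ p * x - β ^ p * y) ^ 2 =
          (α ^ (-p) * α ^ p) * (α ^ p * β ^ (-p)) * x ^ 2
            - 2 * (α ^ (-p) * α ^ p) * (β ^ (-p) * β ^ p) * x * y
            + (β ^ (-p) * β ^ p) * (β ^ p * α ^ (-p)) * y ^ 2 := by ring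
      have h3 : m / 2 * (α ^ p * x ^ 2 + β ^ p * y ^ 2) =
          ((α ^ (-p) * α ^ p) * x ^ 2 + (α ^ p * β ^ (-p)) * x ^ 2
            + (β ^ p * α ^ (-p)) * y ^ 2 + (β ^ (-p) * β ^ p) * y ^ 2) / 4 := by
        rw [hm]; ring
      rw [h2, hA, hB] at h1
      rw [h3, hA, hB]
      nlinarith
    calc _ ≤ |ξ| ^ (2 * r) * (m / 2 * (α ^ p * x ^ 2 + β ^ p * y ^ 2)) :=
          mul_le_mul_of_nonneg_left (hsq.trans cs) hw
      _ = _ := by ring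
  have meas : ∀ a : ℝ, Measurable fun ξ : ℝ =>
      ENNReal.ofReal (|ξ| ^ (2 * r) * ‖fourierHat g (a * ξ)‖ ^ 2) := by
    intro a
    have : Measurable fun ξ : ℝ => ‖fourierHat g (a * ξ)‖ :=
      (hc.comp (continuous_const.mul continuous_id)).norm.measurable
    fun_prop
  have exps : ∀ a : ℝ, 0 < a → a ^ p * a ^ (-(2 * r + 1)) = a ^ (-p) := by
    intro a ha
    rw [← Real.rpow_add ha]
    congr 1
    rw [hp]; ring
  calc sobolevNorm r (densityStep σ lam h g) ≤ _ := lintegral_mono pw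
    _ = ENNReal.ofReal (m / 2) * ((ENNReal.ofReal (α ^ (-p)) + ENNReal.ofReal (β ^ (-p))) *
          sobolevNorm r g) := by
        rw [lintegral_const_mul' _ _ ENNReal.ofReal_ne_top,
          lintegral_add_left ((meas α).const_mul _),
          lintegral_const_mul' _ _ ENNReal.ofReal_ne_top,
          lintegral_const_mul' _ _ ENNReal.ofReal_ne_top,
          lintegral_weight_fourierHat_comp_mul hα0, lintegral_weight_fourierHat_comp_mul hβ0,
          ← mul_assoc (ENNReal.ofReal (α ^ p)), ← mul_assoc (ENNReal.ofReal (β ^ p)),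
          ← ENNReal.ofReal_mul (by positivity), ← ENNReal.ofReal_mul (by positivity),
          exps α hα0, exps β hβ0, add_mul]
    _ = ENNReal.ofReal (m ^ 2) * sobolevNorm r g := by
        rw [← ENNReal.ofReal_add (by positivity) (by positivity), ← mul_assoc,
          ← ENNReal.ofReal_mul (by positivity)]
        congr 2
        rw [hm]; ring
    _ ≤ _ := by
        gcongr
        have h1 := mean_stepFactor_rpow_neg_le hσ lam h p
        calc m ^ 2 ≤ Real.exp (p * (lam + σ * (p + 1) / 2) * h ^ 2) ^ 2 := by gcongr
          _ = _ := by
            rw [← Real.exp_nat_mul, hp]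
            congr 1
            push_cast
            ring

theorem IsProbabilityDensity.densityStep_iterate (σ lam h : ℝ) {g : ℝ → ℝ}
    (hg : IsProbabilityDensity g) (n : ℕ) :
    IsProbabilityDensity ((WealthFP.densityStep σ lam h)^[n] g) := by
  induction n with
  | zero => exact hg
  | succ n ih =>
    rw [Function.iterate_succ_apply']
    exact ih.densityStep σ lam h

theorem sobolevNorm_densityStep_iterate_le {σ : ℝ} (hσ : 0 ≤ σ) (lam h r : ℝ) {g : ℝ → ℝ}
    (hg : IsProbabilityDensity g) (n : ℕ) :
    sobolevNorm r ((densityStep σ lam h)^[n] g) ≤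
      ENNReal.ofReal
        (Real.exp ((2 * r + 1) / 2 * (σ * ((2 * r + 3) / 2) + 2 * lam) * (n * h ^ 2))) *
        sobolevNorm r g := by
  induction n with
  | zero => simp
  | succ n ih =>
    rw [Function.iterate_succ_apply']
    refine (sobolevNorm_densityStep_le hσ lam h r
      (hg.densityStep_iterate σ lam h n).integrable).trans ?_
    refine (mul_le_mul_right ih _).trans_eq ?_
    rw [← mul_assoc, ← ENNReal.ofReal_mul (by positivity), ← Real.exp_add]
    congr 3
    push_cast
    ring

/-! ### Scale-invariant bounds for test functions -/

/-- The derivatives of `u` up to order four, and their products with `v ^ k` (`k` the order of the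
derivative), are bounded by `K`. These are the bounds that control the degenerate operator
`v² ∂²` and that random affine maps of small moments propagate. -/
def EulerBound (u : ℝ → ℝ) (K : ℝ) : Prop :=
  ∀ k ≤ 4, ∀ v, |iteratedDeriv k u v| ≤ K ∧ |v| ^ k * |iteratedDeriv k u v| ≤ K

theorem EulerBound.nonneg {u : ℝ → ℝ} {K : ℝ} (hu : EulerBound u K) : 0 ≤ K :=
  (abs_nonneg _).trans (hu 0 (by norm_num) 0).1

theorem EulerBound.pow_mul_le {u : ℝ → ℝ} {K : ℝ} (hu : EulerBound u K) {j k : ℕ} (hjk : j ≤ k)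
    (hk : k ≤ 4) (v : ℝ) : |v| ^ j * |iteratedDeriv k u v| ≤ K := by
  obtain ⟨h1, h2⟩ := hu k hk v
  rcases le_total |v| 1 with hv | hv
  · exact (mul_le_of_le_one_left (abs_nonneg _) (pow_le_one₀ (abs_nonneg _) hv)).trans h1
  · exact (mul_le_mul_of_nonneg_right (pow_le_pow_right₀ hv hjk) (abs_nonneg _)).trans h2

theorem EulerBound.abs_pow_mul_le {u : ℝ → ℝ} {K : ℝ} (hu : EulerBound u K) {j k : ℕ}
    (hjk : j ≤ k) (hk : k ≤ 4) (v : ℝ) : |v ^ j * iteratedDeriv k u v| ≤ K := by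
  rw [abs_mul, abs_pow]
  exact hu.pow_mul_le hjk hk v

theorem EulerBound.add_pow_mul_le {u : ℝ → ℝ} {K : ℝ} (hu : EulerBound u K) {k : ℕ}
    (hk : k ≤ 4) {b : ℝ} (hb : 0 ≤ b) (v : ℝ) :
    (|v| + b) ^ k * |iteratedDeriv k u v| ≤ (1 + b) ^ k * K := by
  rw [add_pow, add_pow, Finset.sum_mul, Finset.sum_mul]
  refine Finset.sum_le_sum fun i hi => ?_
  have h1 := hu.pow_mul_le (Nat.lt_succ_iff.1 (Finset.mem_range.1 hi)) hk v
  calc |v| ^ i * b ^ (k - i) * (k.choose i : ℝ) * |iteratedDeriv k u v|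
      = b ^ (k - i) * (k.choose i : ℝ) * (|v| ^ i * |iteratedDeriv k u v|) := by ring
    _ ≤ b ^ (k - i) * (k.choose i : ℝ) * K := by gcongr
    _ = _ := by rw [one_pow]; ring

theorem IsTestFunction.hasCompactSupport_iteratedDeriv {u : ℝ → ℝ} (hu : IsTestFunction u)
    (k : ℕ) : HasCompactSupport (iteratedDeriv k u) := by
  induction k with
  | zero => simpa using hu.2
  | succ k ih => rw [iteratedDeriv_succ]; exact ih.deriv

theorem IsTestFunction.continuous_iteratedDeriv {u : ℝ → ℝ} (hu : IsTestFunction u) (k : ℕ) :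
    Continuous (iteratedDeriv k u) :=
  hu.1.continuous_iteratedDeriv k (by exact_mod_cast le_top)

theorem IsTestFunction.exists_eulerBound {u : ℝ → ℝ} (hu : IsTestFunction u) :
    ∃ K, EulerBound u K := by
  have h1 : ∀ k, ∃ C, ∀ v, ‖iteratedDeriv k u v‖ ≤ C := fun k =>
    (hu.hasCompactSupport_iteratedDeriv k).exists_bound_of_continuous (hu.continuous_iteratedDeriv k)
  have h2 : ∀ k, ∃ C, ∀ v, ‖v ^ k * iteratedDeriv k u v‖ ≤ C := fun k =>
    HasCompactSupport.exists_bound_of_continuous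
      ((hu.hasCompactSupport_iteratedDeriv k).mul_left (f := fun v : ℝ => v ^ k))
      (by have := hu.continuous_iteratedDeriv k; fun_prop)
  choose C hC using h1
  choose D hD using h2
  have hC0 : ∀ k, 0 ≤ C k := fun k => (norm_nonneg _).trans (hC k 0)
  have hD0 : ∀ k, 0 ≤ D k := fun k => (norm_nonneg _).trans (hD k 0)
  refine ⟨∑ k ∈ Finset.range 5, (C k + D k), fun k hk v => ?_⟩
  have hle : C k + D k ≤ ∑ k ∈ Finset.range 5, (C k + D k) :=
    Finset.single_le_sum (f := fun k => C k + D k) (fun i _ => add_nonneg (hC0 i) (hD0 i))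
      (Finset.mem_range.2 (by omega))
  constructor
  · exact (hC k v).trans ((le_add_of_nonneg_right (hD0 k)).trans hle)
  · have := hD k v
    rw [norm_mul, norm_pow, Real.norm_eq_abs, Real.norm_eq_abs] at this
    exact this.trans ((le_add_of_nonneg_left (hC0 k)).trans hle)

/-! ### Propagation of the bounds along one step -/

theorem IsTestFunction.comp_affine {u : ℝ → ℝ} (hu : IsTestFunction u) {a : ℝ} (ha : a ≠ 0)
    (b : ℝ) : IsTestFunction fun v => u (a * v + b) :=
  ⟨hu.1.comp (by fun_prop),
    hu.2.comp_homeomorph ((Homeomorph.mulLeft₀ a ha).trans (Homeomorph.addRight b))⟩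

theorem IsTestFunction.add {u w : ℝ → ℝ} (hu : IsTestFunction u) (hw : IsTestFunction w) :
    IsTestFunction fun v => u v + w v :=
  ⟨hu.1.add hw.1, HasCompactSupport.add hu.2 hw.2⟩

theorem IsTestFunction.mul_left {u w : ℝ → ℝ} (hw : ContDiff ℝ (⊤ : ℕ∞) w)
    (hu : IsTestFunction u) : IsTestFunction fun v => w v * u v :=
  ⟨hw.mul hu.1, HasCompactSupport.mul_left hu.2⟩

theorem IsTestFunction.deriv {u : ℝ → ℝ} (hu : IsTestFunction u) : IsTestFunction (deriv u) :=
  ⟨(contDiff_infty_iff_deriv.1 hu.1).2, HasCompactSupport.deriv hu.2⟩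

theorem IsTestFunction.observableStep (σ lam h : ℝ) {u : ℝ → ℝ} (hu : IsTestFunction u) :
    IsTestFunction (observableStep σ lam h u) := by
  have h1 := (hu.comp_affine (stepFactor_pos σ lam h).ne' (lam * h ^ 2)).add
    (hu.comp_affine (stepFactor_pos σ lam (-h)).ne' (lam * h ^ 2))
  have h2 := h1.mul_left (w := fun _ => (1 / 2 : ℝ)) contDiff_const
  convert h2 using 2 with v
  rw [WealthFP.observableStep]; ring

theorem IsTestFunction.contDiff_nat {u : ℝ → ℝ} (hu : IsTestFunction u) (k : ℕ) :
    ContDiff ℝ k u :=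
  hu.1.of_le (by exact_mod_cast le_top)

theorem IsTestFunction.iteratedDeriv_comp_affine {u : ℝ → ℝ} (hu : IsTestFunction u) (a b : ℝ)
    (k : ℕ) (v : ℝ) :
    iteratedDeriv k (fun v => u (a * v + b)) v = a ^ k * iteratedDeriv k u (a * v + b) := by
  have h1 : ContDiff ℝ k (fun z => u (z + b)) := (hu.contDiff_nat k).comp (by fun_prop)
  have h2 := congrFun (iteratedDeriv_comp_const_mul h1 a) v
  rw [iteratedDeriv_comp_add_const] at h2
  exact h2

theorem IsTestFunction.iteratedDeriv_observableStep (σ lam h : ℝ) {u : ℝ → ℝ}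
    (hu : IsTestFunction u) (k : ℕ) (v : ℝ) :
    iteratedDeriv k (WealthFP.observableStep σ lam h u) v =
      (stepFactor σ lam h ^ k * iteratedDeriv k u (stepFactor σ lam h * v + lam * h ^ 2) +
      stepFactor σ lam (-h) ^ k *
        iteratedDeriv k u (stepFactor σ lam (-h) * v + lam * h ^ 2)) / 2 := by
  have e : WealthFP.observableStep σ lam h u = fun v => (1 / 2 : ℝ) *
      (u (stepFactor σ lam h * v + lam * h ^ 2) + u (stepFactor σ lam (-h) * v + lam * h ^ 2)) := by
    ext v; rw [WealthFP.observableStep]; ring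
  have h1 := hu.comp_affine (stepFactor_pos σ lam h).ne' (lam * h ^ 2)
  have h2 := hu.comp_affine (stepFactor_pos σ lam (-h)).ne' (lam * h ^ 2)
  rw [e, iteratedDeriv_const_mul _ ((h1.add h2).contDiff_nat k).contDiffAt,
    iteratedDeriv_fun_add (h1.contDiff_nat k).contDiffAt (h2.contDiff_nat k).contDiffAt,
    hu.iteratedDeriv_comp_affine, hu.iteratedDeriv_comp_affine]
  ring

/-- The factor is `1 + O(h²)`, although each multiplier is only `1 + O(h)`: for the unweighted
bounds this is due to the averaging over the two multipliers, while the bounds weighted by `v ^ k`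
are invariant under scaling, and only the shift `lam h²` affects them. -/
theorem EulerBound.observableStep {σ lam : ℝ} (hσ : 0 ≤ σ) (hlam : 0 ≤ lam) (h : ℝ) {u : ℝ → ℝ}
    (hu : IsTestFunction u) {K : ℝ} (hK : EulerBound u K) :
    EulerBound (observableStep σ lam h u) (Real.exp ((6 * σ + 4 * lam) * h ^ 2) * K) := by
  intro k hk v
  have hK0 := hK.nonneg
  have hk' : (k : ℝ) ≤ 4 := by exact_mod_cast hk
  have hb : 0 ≤ lam * h ^ 2 := by positivity
  rw [hu.iteratedDeriv_observableStep]
  set α := stepFactor σ lam h with hα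
  set β := stepFactor σ lam (-h) with hβ
  have hα0 : 0 < α := stepFactor_pos _ _ _
  have hβ0 : 0 < β := stepFactor_pos _ _ _
  set y := α * v + lam * h ^ 2 with hy
  set z := β * v + lam * h ^ 2 with hz
  have tri : |(α ^ k * iteratedDeriv k u y + β ^ k * iteratedDeriv k u z) / 2| ≤
      (α ^ k * |iteratedDeriv k u y| + β ^ k * |iteratedDeriv k u z|) / 2 := by
    rw [abs_div, abs_two]
    gcongr
    refine (abs_add_le _ _).trans ?_
    rw [abs_mul, abs_mul, abs_of_pos (pow_pos hα0 k), abs_of_pos (pow_pos hβ0 k)]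
  constructor
  · refine tri.trans ?_
    have h1 : (α ^ k + β ^ k) / 2 ≤ Real.exp ((6 * σ + 4 * lam) * h ^ 2) := by
      have := mean_stepFactor_rpow_neg_le hσ lam h (-(k : ℝ))
      rw [neg_neg, Real.rpow_natCast, Real.rpow_natCast] at this
      refine this.trans (Real.exp_le_exp.2 ?_)
      refine mul_le_mul_of_nonneg_right ?_ (sq_nonneg h)
      interval_cases k <;> push_cast <;> nlinarith
    calc _ ≤ (α ^ k * K + β ^ k * K) / 2 := by
          gcongr
          · exact (hK k hk y).1
          · exact (hK k hk z).1
      _ = (α ^ k + β ^ k) / 2 * K := by ring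
      _ ≤ _ := by gcongr
  · have scaled : ∀ a : ℝ, 0 < a → |v| ^ k * (a ^ k * |iteratedDeriv k u (a * v + lam * h ^ 2)|) ≤
        (1 + lam * h ^ 2) ^ k * K := by
      intro a ha
      have h1 : a * |v| ≤ |a * v + lam * h ^ 2| + lam * h ^ 2 := by
        calc a * |v| = |a * v + lam * h ^ 2 - lam * h ^ 2| := by
              rw [add_sub_cancel_right, abs_mul, abs_of_pos ha]
          _ ≤ _ := (abs_sub _ _).trans_eq (by rw [abs_of_nonneg hb])
      calc _ = (a * |v|) ^ k * |iteratedDeriv k u (a * v + lam * h ^ 2)| := by ring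
        _ ≤ (|a * v + lam * h ^ 2| + lam * h ^ 2) ^ k *
            |iteratedDeriv k u (a * v + lam * h ^ 2)| := by gcongr
        _ ≤ _ := hK.add_pow_mul_le hk hb _
    have h2 : (1 + lam * h ^ 2) ^ k ≤ Real.exp ((6 * σ + 4 * lam) * h ^ 2) := by
      calc (1 + lam * h ^ 2) ^ k ≤ Real.exp (lam * h ^ 2) ^ k := by
            gcongr
            rw [add_comm]
            exact Real.add_one_le_exp _
        _ = Real.exp (k * (lam * h ^ 2)) := (Real.exp_nat_mul _ _).symm
        _ ≤ _ := by
            apply Real.exp_le_exp.2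
            have : (k : ℝ) * (lam * h ^ 2) ≤ 4 * (lam * h ^ 2) := by gcongr
            nlinarith [mul_nonneg hσ (sq_nonneg h)]
    calc _ ≤ |v| ^ k * ((α ^ k * |iteratedDeriv k u y| + β ^ k * |iteratedDeriv k u z|) / 2) := by
          gcongr
      _ = (|v| ^ k * (α ^ k * |iteratedDeriv k u y|) +
            |v| ^ k * (β ^ k * |iteratedDeriv k u z|)) / 2 := by ring
      _ ≤ ((1 + lam * h ^ 2) ^ k * K + (1 + lam * h ^ 2) ^ k * K) / 2 := by
          linarith [scaled α hα0, scaled β hβ0]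
      _ = (1 + lam * h ^ 2) ^ k * K := by ring
      _ ≤ _ := by gcongr

/-! ### The adjoint operator on test functions -/

theorem adjointOperator_eq_iteratedDeriv (σ lam : ℝ) (u : ℝ → ℝ) (v : ℝ) :
    adjointOperator σ lam u v =
      σ / 2 * v ^ 2 * iteratedDeriv 2 u v - lam * (v - 1) * iteratedDeriv 1 u v := by
  rw [adjointOperator, iteratedDeriv_one, iteratedDeriv_succ, iteratedDeriv_one]

theorem IsTestFunction.adjointOperator (σ lam : ℝ) {u : ℝ → ℝ} (hu : IsTestFunction u) :
    IsTestFunction (adjointOperator σ lam u) := by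
  have h := (hu.deriv.deriv.mul_left (w := fun v => σ / 2 * v ^ 2) (by fun_prop)).add
    (hu.deriv.mul_left (w := fun v => -(lam * (v - 1))) (by fun_prop))
  convert h using 2 with v
  rw [WealthFP.adjointOperator]; ring

theorem EulerBound.abs_adjointOperator_le {σ lam : ℝ} (hσ : 0 ≤ σ) (hlam : 0 ≤ lam) {u : ℝ → ℝ}
    {K : ℝ} (hK : EulerBound u K) (v : ℝ) :
    |adjointOperator σ lam u v| ≤ (σ + 2 * lam) * K := by
  rw [adjointOperator_eq_iteratedDeriv]
  have h1 := abs_le.1 (hK.abs_pow_mul_le (j := 2) (k := 2) le_rfl (by norm_num) v)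
  have h2 := abs_le.1 (hK.abs_pow_mul_le (j := 1) (k := 1) le_rfl (by norm_num) v)
  have h3 := abs_le.1 (hK.abs_pow_mul_le (j := 0) (k := 1) (by norm_num) (by norm_num) v)
  have hK0 := hK.nonneg
  rw [abs_le]
  constructor
  · nlinarith [mul_nonneg hσ hK0]
  · nlinarith [mul_nonneg hσ hK0]

theorem IsTestFunction.hasDerivAt_iteratedDeriv {u : ℝ → ℝ} (hu : IsTestFunction u) (k : ℕ)
    (v : ℝ) : HasDerivAt (iteratedDeriv k u) (iteratedDeriv (k + 1) u v) v := by
  rw [iteratedDeriv_succ]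
  refine DifferentiableAt.hasDerivAt ?_
  exact (hu.1.differentiable_iteratedDeriv k
    (by exact_mod_cast ENat.natCast_lt_top k)).differentiableAt

/-- The square of the adjoint operator has order four; each of its terms carries at most as many
powers of `v` as derivatives. -/
theorem exists_abs_adjointOperator_adjointOperator_le (σ lam : ℝ) :
    ∃ C, 0 ≤ C ∧ ∀ (u : ℝ → ℝ) (K : ℝ), IsTestFunction u → EulerBound u K → ∀ v,
      |adjointOperator σ lam (adjointOperator σ lam u) v| ≤ C * K := by
  let c : Fin 8 → ℝ := ![σ / 2 * (σ - 2 * lam) + lam * (lam - σ), -2 * lam ^ 2 + σ * lam, lam ^ 2,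
    σ / 2 * (2 * σ - lam) - lam * σ / 2, σ / 2 * lam + lam * σ / 2, σ ^ 2 / 4,
    lam ^ 2, -lam ^ 2]
  refine ⟨∑ i, |c i|, Finset.sum_nonneg fun i _ => abs_nonneg _, fun u K hu hK v => ?_⟩
  have d1 : deriv (adjointOperator σ lam u) = fun v =>
      -lam * iteratedDeriv 1 u v + (σ * v - lam * (v - 1)) * iteratedDeriv 2 u v +
        σ / 2 * v ^ 2 * iteratedDeriv 3 u v := by
    ext w
    have e : adjointOperator σ lam u = fun v =>
      σ / 2 * v ^ 2 * iteratedDeriv 2 u v - lam * (v - 1) * iteratedDeriv 1 u v :=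
      funext (adjointOperator_eq_iteratedDeriv σ lam u)
    rw [e]
    have h := ((((hasDerivAt_id w).pow 2).const_mul (σ / 2)).mul
      (hu.hasDerivAt_iteratedDeriv 2 w)).sub
      ((((hasDerivAt_id w).sub_const 1).const_mul lam).mul (hu.hasDerivAt_iteratedDeriv 1 w))
    refine (h.congr_deriv ?_).deriv
    simp
    ring
  have d2 : deriv (deriv (adjointOperator σ lam u)) v =
      (σ - 2 * lam) * iteratedDeriv 2 u v + (2 * σ * v - lam * (v - 1)) * iteratedDeriv 3 u v +
        σ / 2 * v ^ 2 * iteratedDeriv 4 u v := by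
    rw [d1]
    have h := (((hu.hasDerivAt_iteratedDeriv 1 v).const_mul (-lam)).add
      ((((hasDerivAt_id v).const_mul σ).sub (((hasDerivAt_id v).sub_const 1).const_mul lam)).mul
        (hu.hasDerivAt_iteratedDeriv 2 v))).add
      ((((hasDerivAt_id v).pow 2).const_mul (σ / 2)).mul (hu.hasDerivAt_iteratedDeriv 3 v))
    refine (h.congr_deriv ?_).deriv
    simp
    ring
  let m : Fin 8 → ℝ := ![v ^ 2 * iteratedDeriv 2 u v, v ^ 1 * iteratedDeriv 2 u v,
    v ^ 0 * iteratedDeriv 2 u v, v ^ 3 * iteratedDeriv 3 u v, v ^ 2 * iteratedDeriv 3 u v,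
    v ^ 4 * iteratedDeriv 4 u v, v ^ 1 * iteratedDeriv 1 u v, v ^ 0 * iteratedDeriv 1 u v]
  have hm : ∀ i, |m i| ≤ K := by
    intro i
    fin_cases i <;> exact hK.abs_pow_mul_le (by norm_num) (by norm_num) v
  have e : adjointOperator σ lam (adjointOperator σ lam u) v = ∑ i, c i * m i := by
    rw [adjointOperator, d2, d1]
    simp [c, m, Fin.sum_univ_succ]
    ring
  rw [e, Finset.sum_mul]
  refine (Finset.abs_sum_le_sum_abs _ _).trans (Finset.sum_le_sum fun i _ => ?_)
  rw [abs_mul]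
  exact mul_le_mul_of_nonneg_left (hm i) (abs_nonneg _)

/-! ### Consistency of one step with the adjoint operator -/

theorem EulerBound.abs_taylor_two_le {u : ℝ → ℝ} (hu : IsTestFunction u) {K : ℝ}
    (hK : EulerBound u K) {δ d v : ℝ} (hδ : δ ≤ 1 / 2) (hd : |d| ≤ δ * (|v| + 1)) :
    |u (v + d) - u v - d * iteratedDeriv 1 u v - d ^ 2 / 2 * iteratedDeriv 2 u v| ≤
      11 * δ ^ 3 * K := by
  set w : ℝ → ℝ := fun s => u (d * s + v) with hwdef
  have hwk : ∀ k s, iteratedDeriv k w s = d ^ k * iteratedDeriv k u (d * s + v) :=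
    fun k s => hu.iteratedDeriv_comp_affine d v k s
  have hwc : ContDiff ℝ 3 w := (hu.contDiff_nat 3).comp (by fun_prop)
  obtain ⟨s, hs, hs'⟩ := taylor_mean_remainder_lagrange_iteratedDeriv (f := w) (x := 1) (x₀ := 0)
    (n := 2) zero_ne_one (by exact_mod_cast hwc.contDiffOn)
  have hwithin : ∀ k ≤ 2, iteratedDerivWithin k w (uIcc (0 : ℝ) 1) 0 = iteratedDeriv k w 0 := by
    intro k hk
    refine iteratedDerivWithin_eq_iteratedDeriv ?_ ?_ left_mem_uIcc
    · rw [uIcc_of_le zero_le_one]; exact uniqueDiffOn_Icc zero_lt_one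
    · exact (hwc.of_le (by exact_mod_cast hk.trans (by norm_num))).contDiffAt
  have hT : taylorWithinEval w 2 (uIcc (0 : ℝ) 1) 0 1 =
      u v + d * iteratedDeriv 1 u v + d ^ 2 / 2 * iteratedDeriv 2 u v := by
    rw [taylor_within_apply]
    simp only [Finset.sum_range_succ, Finset.range_zero, Finset.sum_empty,
      hwithin 0 (by norm_num), hwithin 1 (by norm_num), hwithin 2 le_rfl, hwk]
    simp
    ring
  rw [hT, hwk] at hs'
  rw [uIoo_of_le zero_le_one] at hs
  set z := d * s + v with hz
  have e : u (v + d) - u v - d * iteratedDeriv 1 u v - d ^ 2 / 2 * iteratedDeriv 2 u v =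
      d ^ 3 * iteratedDeriv 3 u z / 6 := by
    have : w 1 = u (v + d) := by simp only [hwdef]; ring_nf
    rw [this] at hs'
    norm_num [Nat.factorial] at hs'
    rw [iteratedDeriv_one]
    linarith
  rw [e, abs_div, abs_mul, abs_pow]
  have hδ0 : 0 ≤ δ := by
    by_contra hneg
    have : δ * (|v| + 1) < 0 := mul_neg_of_neg_of_pos (not_le.1 hneg) (by positivity)
    linarith [abs_nonneg d]
  -- The intermediate point is comparable with `v` because the displacement is at most half of it.
  have hzv : |d| ≤ 2 * δ * (|z| + 1) := by
    have h1 : |v| ≤ |z| + |d| := by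
      calc |v| = |z - d * s| := by rw [hz]; congr 1; ring
        _ ≤ |z| + |d * s| := abs_sub _ _
        _ ≤ _ := by
          rw [abs_mul, abs_of_pos hs.1]
          gcongr
          exact mul_le_of_le_one_right (abs_nonneg _) hs.2.le
    have h2 : |v| + 1 ≤ 2 * (|z| + 1) := by nlinarith [abs_nonneg v]
    calc |d| ≤ δ * (|v| + 1) := hd
      _ ≤ δ * (2 * (|z| + 1)) := by gcongr
      _ = _ := by ring
  have h3 := hK.add_pow_mul_le (k := 3) (by norm_num) zero_le_one z
  calc |d| ^ 3 * |iteratedDeriv 3 u z| / |6|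
      ≤ (2 * δ * (|z| + 1)) ^ 3 * |iteratedDeriv 3 u z| / |6| := by gcongr
    _ = 8 * δ ^ 3 * ((|z| + 1) ^ 3 * |iteratedDeriv 3 u z|) / 6 := by
        rw [abs_of_pos (by norm_num : (0 : ℝ) < 6)]; ring
    _ ≤ 8 * δ ^ 3 * ((1 + 1) ^ 3 * K) / 6 := by gcongr
    _ ≤ 11 * δ ^ 3 * K := by nlinarith [mul_nonneg (pow_nonneg hδ0 3) hK.nonneg]

/-- The correction `-σ / 2` in the drift of `log A` cancels the second-order term of the
exponential, which leaves the drift `-lam`. -/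
theorem exists_abs_stepFactor_sub_le {σ lam : ℝ} (hσ : 0 ≤ σ) (hlam : 0 ≤ lam) :
    ∃ C h₀, 0 ≤ C ∧ 0 < h₀ ∧ h₀ ≤ 1 ∧ ∀ h, |h| ≤ h₀ →
      |stepFactor σ lam h - 1 - (√σ * h - lam * h ^ 2)| ≤ C * |h| ^ 3 := by
  set s := √σ with hs
  have hs0 : 0 ≤ s := Real.sqrt_nonneg _
  have hs2 : s ^ 2 = σ := Real.sq_sqrt hσ
  set μ := lam + σ / 2 with hμ
  have hμ0 : 0 ≤ μ := by positivity
  refine ⟨(s + μ) ^ 3 + s * μ + μ ^ 2, (s + μ + 1)⁻¹, by positivity, by positivity,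
    inv_le_one_of_one_le₀ (by linarith), fun h hh => ?_⟩
  have hh1 : |h| ≤ 1 := hh.trans (inv_le_one_of_one_le₀ (by linarith))
  have hh0 := abs_nonneg h
  have hh2 : |h| ^ 2 ≤ |h| := by nlinarith
  set x := s * h - μ * h ^ 2 with hx
  have hxh : |x| ≤ (s + μ) * |h| := by
    calc |x| ≤ |s * h| + |μ * h ^ 2| := abs_sub _ _
      _ = s * |h| + μ * |h| ^ 2 := by
        rw [abs_mul, abs_mul, abs_of_nonneg hs0, abs_of_nonneg hμ0, abs_pow]
      _ ≤ s * |h| + μ * |h| := by gcongr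
      _ = _ := by ring
  have hx1 : |x| ≤ 1 := by
    have h1 : (s + μ) * |h| ≤ (s + μ) * (s + μ + 1)⁻¹ := by gcongr
    have h2 : (s + μ) * (s + μ + 1)⁻¹ ≤ 1 := by
      rw [← div_eq_mul_inv, div_le_one (by positivity)]; linarith
    linarith
  have hexp := Real.exp_bound hx1 (n := 3) (by norm_num)
  simp only [Finset.sum_range_succ, Finset.range_zero, Finset.sum_empty] at hexp
  norm_num [Nat.factorial] at hexp
  have hE : |Real.exp x - (1 + x + x ^ 2 / 2)| ≤ (s + μ) ^ 3 * |h| ^ 3 := by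
    calc _ ≤ |x| ^ 3 * (2 / 9) := hexp
      _ ≤ |x| ^ 3 := mul_le_of_le_one_right (by positivity) (by norm_num)
      _ ≤ ((s + μ) * |h|) ^ 3 := by gcongr
      _ = _ := by ring
  have e : stepFactor σ lam h - 1 - (s * h - lam * h ^ 2) =
      (Real.exp x - (1 + x + x ^ 2 / 2)) + (-(s * μ * h ^ 3) + μ ^ 2 / 2 * h ^ 4) := by
    have h1 : stepFactor σ lam h = Real.exp x := rfl
    have h2 : lam = μ - s ^ 2 / 2 := by rw [hs2, hμ]; ring
    rw [h1, h2, hx]; ring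
  rw [e]
  have h4 : |h| ^ 4 ≤ |h| ^ 3 := pow_le_pow_of_le_one hh0 hh1 (by norm_num)
  calc _ ≤ |Real.exp x - (1 + x + x ^ 2 / 2)| + (|s * μ * h ^ 3| + |μ ^ 2 / 2 * h ^ 4|) := by
        refine (abs_add_le _ _).trans (add_le_add_right ((abs_add_le _ _).trans ?_) _)
        rw [abs_neg]
    _ ≤ (s + μ) ^ 3 * |h| ^ 3 + (s * μ * |h| ^ 3 + μ ^ 2 * |h| ^ 3) := by
        gcongr
        · rw [abs_mul, abs_pow, abs_of_nonneg (mul_nonneg hs0 hμ0)]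
        · rw [abs_mul, abs_pow, abs_of_nonneg (by positivity)]
          gcongr
          linarith [sq_nonneg μ]
    _ = _ := by ring

/-- Second-order expansion in `h` along one value of the noise; the remainder only involves the
scale-invariant bounds of `u`. -/
theorem exists_abs_comp_stepFactor_sub_le {σ lam : ℝ} (hσ : 0 ≤ σ) (hlam : 0 ≤ lam) :
    ∃ C h₀, 0 ≤ C ∧ 0 < h₀ ∧ ∀ h, |h| ≤ h₀ →
      ∀ (u : ℝ → ℝ) (K : ℝ), IsTestFunction u → EulerBound u K → ∀ v,
      |u (stepFactor σ lam h * v + lam * h ^ 2) - u v - √σ * h * v * iteratedDeriv 1 u v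
        - h ^ 2 * adjointOperator σ lam u v| ≤ C * |h| ^ 3 * K := by
  obtain ⟨C₀, h₀, hC₀, hh₀, hh₁, hstep⟩ := exists_abs_stepFactor_sub_le hσ hlam
  set s := √σ with hs
  have hs0 : 0 ≤ s := Real.sqrt_nonneg _
  have hs2 : s ^ 2 = σ := Real.sq_sqrt hσ
  set D := s + lam + C₀ with hD
  have hD0 : 0 ≤ D := by positivity
  refine ⟨11 * D ^ 3 + C₀ + 2 * ((lam + C₀) * (D + s)), min h₀ (2 * D + 1)⁻¹ / 2, by positivity,
    by positivity, fun h hh u K hu hK v => ?_⟩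
  have hmin : min h₀ (2 * D + 1)⁻¹ / 2 ≤ min h₀ (2 * D + 1)⁻¹ := half_le_self (by positivity)
  have hhh := hstep h (hh.trans (hmin.trans (min_le_left _ _)))
  have hh1 : |h| ≤ 1 := (hh.trans (hmin.trans (min_le_left _ _))).trans hh₁
  have hδ : D * |h| ≤ 1 / 2 := by
    have h1 : |h| ≤ (2 * D + 1)⁻¹ / 2 := hh.trans (by gcongr; exact min_le_right _ _)
    have h2 : D * |h| ≤ D * ((2 * D + 1)⁻¹ / 2) := by gcongr
    have h3 : D * ((2 * D + 1)⁻¹ / 2) ≤ 1 / 2 := by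
      rw [mul_div_assoc', ← div_eq_mul_inv]
      gcongr
      rw [div_le_one (by positivity)]
      linarith
    linarith
  have hh0 := abs_nonneg h
  have hh2 : |h| ^ 2 ≤ |h| := by nlinarith
  have hh3 : |h| ^ 3 ≤ |h| ^ 2 := pow_le_pow_of_le_one hh0 hh1 (by norm_num)
  set ρ := stepFactor σ lam h - 1 - (s * h - lam * h ^ 2) with hρ
  set d := s * h * v - lam * h ^ 2 * (v - 1) + ρ * v with hd
  have hvd : stepFactor σ lam h * v + lam * h ^ 2 = v + d := by rw [hd, hρ]; ring
  have hv0 := abs_nonneg v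
  -- The part of the displacement that is of second order in `h`.
  have hd2 : |d - s * h * v| ≤ (lam + C₀) * |h| ^ 2 * (|v| + 1) := by
    have e : d - s * h * v = -(lam * h ^ 2 * (v - 1)) + ρ * v := by rw [hd]; ring
    have h1 : |lam * h ^ 2 * (v - 1)| ≤ lam * |h| ^ 2 * (|v| + 1) := by
      rw [abs_mul, abs_mul, abs_of_nonneg hlam, abs_pow]
      gcongr
      simpa using abs_sub v 1
    have h2 : |ρ * v| ≤ C₀ * |h| ^ 2 * (|v| + 1) := by
      rw [abs_mul]
      exact mul_le_mul (hhh.trans (by gcongr)) (by linarith) hv0 (by positivity)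
    rw [e]
    refine (abs_add_le _ _).trans ?_
    rw [abs_neg]
    linarith
  have hshv : |s * h * v| ≤ s * |h| * (|v| + 1) := by
    rw [abs_mul, abs_mul, abs_of_nonneg hs0]
    gcongr
    linarith
  have hd1 : |d| ≤ D * |h| * (|v| + 1) := by
    have e : d = (d - s * h * v) + s * h * v := by ring
    rw [e]
    refine (abs_add_le _ _).trans ?_
    have : (lam + C₀) * |h| ^ 2 * (|v| + 1) ≤ (lam + C₀) * |h| * (|v| + 1) := by gcongr
    calc _ ≤ (lam + C₀) * |h| * (|v| + 1) + s * |h| * (|v| + 1) := by linarith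
      _ = _ := by rw [hD]; ring
  have htaylor := hK.abs_taylor_two_le hu hδ hd1
  have hK0 := hK.nonneg
  have hA : |ρ * (v * iteratedDeriv 1 u v)| ≤ C₀ * |h| ^ 3 * K := by
    rw [abs_mul]
    have := hK.abs_pow_mul_le (j := 1) (k := 1) le_rfl (by norm_num) v
    rw [pow_one] at this
    gcongr
  have hB : |(d ^ 2 - σ * h ^ 2 * v ^ 2) / 2 * iteratedDeriv 2 u v| ≤
      2 * ((lam + C₀) * (D + s)) * |h| ^ 3 * K := by
    have h1 : d ^ 2 - σ * h ^ 2 * v ^ 2 = (d - s * h * v) * (d + s * h * v) := by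
      rw [← hs2]; ring
    have h2 : |d + s * h * v| ≤ (D + s) * |h| * (|v| + 1) := by
      refine (abs_add_le _ _).trans ?_
      linarith
    have h3 := hK.add_pow_mul_le (k := 2) (by norm_num) zero_le_one v
    rw [h1, abs_mul, abs_div, abs_mul, abs_two]
    calc _ ≤ ((lam + C₀) * |h| ^ 2 * (|v| + 1)) * ((D + s) * |h| * (|v| + 1)) / 2 *
          |iteratedDeriv 2 u v| := by gcongr
      _ = (lam + C₀) * (D + s) * |h| ^ 3 / 2 * ((|v| + 1) ^ 2 * |iteratedDeriv 2 u v|) := by ring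
      _ ≤ (lam + C₀) * (D + s) * |h| ^ 3 / 2 * ((1 + 1) ^ 2 * K) := by gcongr
      _ = _ := by ring
  have e : u (stepFactor σ lam h * v + lam * h ^ 2) - u v - s * h * v * iteratedDeriv 1 u v
        - h ^ 2 * adjointOperator σ lam u v =
      (u (v + d) - u v - d * iteratedDeriv 1 u v - d ^ 2 / 2 * iteratedDeriv 2 u v) +
      (ρ * (v * iteratedDeriv 1 u v) + (d ^ 2 - σ * h ^ 2 * v ^ 2) / 2 * iteratedDeriv 2 u v) := by
    have e1 : ρ * v = d - s * h * v + lam * h ^ 2 * (v - 1) := by rw [hd]; ring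
    rw [hvd, adjointOperator_eq_iteratedDeriv, ← mul_assoc, e1]
    ring
  rw [e]
  refine (abs_add_le _ _).trans ?_
  have h5 := abs_add_le (ρ * (v * iteratedDeriv 1 u v))
    ((d ^ 2 - σ * h ^ 2 * v ^ 2) / 2 * iteratedDeriv 2 u v)
  calc _ ≤ 11 * (D * |h|) ^ 3 * K + (C₀ * |h| ^ 3 * K +
        2 * ((lam + C₀) * (D + s)) * |h| ^ 3 * K) := by linarith
    _ = _ := by ring

/-- The first-order terms of the expansions at `h` and `-h` have opposite signs and cancel. -/
theorem exists_abs_observableStep_sub_le {σ lam : ℝ} (hσ : 0 ≤ σ) (hlam : 0 ≤ lam) :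
    ∃ C h₀, 0 ≤ C ∧ 0 < h₀ ∧ ∀ h, 0 ≤ h → h ≤ h₀ →
      ∀ (u : ℝ → ℝ) (K : ℝ), IsTestFunction u → EulerBound u K → ∀ v,
      |observableStep σ lam h u v - u v - h ^ 2 * adjointOperator σ lam u v| ≤ C * h ^ 3 * K := by
  obtain ⟨C, h₀, hC, hh₀, H⟩ := exists_abs_comp_stepFactor_sub_le hσ hlam
  refine ⟨C, h₀, hC, hh₀, fun h hh0 hh u K hu hK v => ?_⟩
  have h1 := abs_le.1 (H h (by rwa [abs_of_nonneg hh0]) u K hu hK v)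
  have h2 := abs_le.1 (H (-h) (by rwa [abs_neg, abs_of_nonneg hh0]) u K hu hK v)
  rw [abs_of_nonneg hh0] at h1
  rw [abs_neg, abs_of_nonneg hh0, neg_sq] at h2
  rw [observableStep, abs_le]
  constructor <;> linarith [h1.1, h1.2, h2.1, h2.2]

/-! ### Solutions tested against smooth functions -/

theorem IsSolution.exists_integral_abs_le {σ lam T : ℝ} {f₀ : ℝ → ℝ} {f : ℝ → ℝ → ℝ}
    (hf : IsSolution σ lam T f₀ f) :
    ∃ M : ℝ, 0 ≤ M ∧ ∀ t ∈ Icc 0 T, Integrable (f t) ∧ ∫ v, |f t v| ≤ M := by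
  obtain ⟨M, hM⟩ := hf.bounded
  refine ⟨M, M.2, fun t ht => ?_⟩
  have h1 := (hM t ht).1
  have hint : Integrable (f t) :=
    memLp_one_iff_integrable.1
      ⟨hf.aestronglyMeasurable_slice t ht, h1.trans_lt ENNReal.coe_lt_top⟩
  refine ⟨hint, ?_⟩
  have h2 : ∫ v, |f t v| = (eLpNorm (f t) 1 volume).toReal := by
    rw [eLpNorm_one_eq_lintegral_enorm]
    exact integral_norm_eq_lintegral_enorm hint.1
  rw [h2]
  exact ENNReal.toReal_le_of_le_ofReal M.2 (by simpa using h1)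

theorem abs_integral_mul_le_of_abs_le {g w : ℝ → ℝ} (hg : Integrable g) {B M : ℝ} (hB : 0 ≤ B)
    (hw : ∀ v, |w v| ≤ B) (hM : ∫ v, |g v| ≤ M) : |∫ v, w v * g v| ≤ B * M := by
  calc |∫ v, w v * g v| ≤ ∫ v, B * |g v| := by
        rw [← Real.norm_eq_abs]
        refine norm_integral_le_of_norm_le (hg.abs.const_mul B)
          (Filter.Eventually.of_forall fun v => ?_)
        rw [Real.norm_eq_abs, abs_mul]
        exact mul_le_mul_of_nonneg_right (hw v) (abs_nonneg _)
    _ = B * ∫ v, |g v| := integral_const_mul _ _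
    _ ≤ _ := by gcongr

theorem IsTestFunction.exists_abs_le {u : ℝ → ℝ} (hu : IsTestFunction u) :
    ∃ B, ∀ v, |u v| ≤ B :=
  hu.2.exists_bound_of_continuous hu.1.continuous

theorem IsTestFunction.integrable_mul {u g : ℝ → ℝ} (hu : IsTestFunction u) (hg : Integrable g) :
    Integrable fun v => u v * g v := by
  obtain ⟨B, hB⟩ := hu.exists_abs_le
  exact integrable_mul_of_abs_le hg hu.1.continuous hB

theorem IsSolution.intervalIntegrable_pairing {σ lam T : ℝ} {f₀ : ℝ → ℝ} {f : ℝ → ℝ → ℝ}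
    (hf : IsSolution σ lam T f₀ f) {w : ℝ → ℝ} (hw : IsTestFunction w) {a b : ℝ}
    (ha : a ∈ Icc 0 T) (hb : b ∈ Icc 0 T) :
    IntervalIntegrable (fun s => ∫ v, w v * f s v) volume a b := by
  obtain ⟨M, hM0, hM⟩ := hf.exists_integral_abs_le
  obtain ⟨B, hB⟩ := hw.exists_abs_le
  have hB0 : 0 ≤ B := (abs_nonneg _).trans (hB 0)
  have hmeas : AEStronglyMeasurable (fun s => ∫ v, w v * f s v) (volume.restrict (Icc 0 T)) := by
    have h1 : AEStronglyMeasurable (fun p : ℝ × ℝ => w p.2 * Function.uncurry f p)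
        ((volume.restrict (Icc 0 T)).prod volume) :=
      (hw.1.continuous.comp continuous_snd).aestronglyMeasurable.mul hf.aestronglyMeasurable
    exact h1.integral_prod_right'
  have hI : IntegrableOn (fun s => ∫ v, w v * f s v) (Icc 0 T) := by
    refine Integrable.of_bound hmeas (B * M) ?_
    refine (ae_restrict_mem measurableSet_Icc).mono fun s hs => ?_
    exact abs_integral_mul_le_of_abs_le (hM s hs).1 hB0 hB (hM s hs).2
  exact (hI.mono_set (uIcc_subset_Icc ha hb)).intervalIntegrable

theorem IsSolution.integral_sub_eq {σ lam T : ℝ} {f₀ : ℝ → ℝ} {f : ℝ → ℝ → ℝ}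
    (hf : IsSolution σ lam T f₀ f) {u : ℝ → ℝ} (hu : IsTestFunction u) {a b : ℝ}
    (ha : a ∈ Icc 0 T) (hb : b ∈ Icc 0 T) :
    (∫ v, u v * f b v) - ∫ v, u v * f a v =
      ∫ s in a..b, ∫ v, adjointOperator σ lam u v * f s v := by
  have h0 : (0 : ℝ) ∈ Icc 0 T := ⟨le_rfl, ha.1.trans ha.2⟩
  rw [hf.weak_form u hu a ha, hf.weak_form u hu b hb, add_sub_add_left_eq_sub,
    intervalIntegral.integral_interval_sub_left
      (hf.intervalIntegrable_pairing (hu.adjointOperator σ lam) h0 hb)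
      (hf.intervalIntegrable_pairing (hu.adjointOperator σ lam) h0 ha)]

theorem IsSolution.integral_zero_eq {σ lam T : ℝ} (hT : 0 ≤ T) {f₀ : ℝ → ℝ} {f : ℝ → ℝ → ℝ}
    (hf : IsSolution σ lam T f₀ f) {u : ℝ → ℝ} (hu : IsTestFunction u) :
    ∫ v, u v * f 0 v = ∫ v, u v * f₀ v := by
  simpa using hf.weak_form u hu 0 ⟨le_rfl, hT⟩

/-- Over a time `h²` the solution and the discrete step differ by `O(h³)`. The increment of the
solution is linearized by using the weak form twice, which costs a bound on the square of
`adjointOperator`. -/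
theorem IsSolution.exists_abs_integral_sub_observableStep_le {σ lam T : ℝ} (hσ : 0 ≤ σ)
    (hlam : 0 ≤ lam) {f₀ : ℝ → ℝ} {f : ℝ → ℝ → ℝ} (hf : IsSolution σ lam T f₀ f) :
    ∃ C h₀, 0 ≤ C ∧ 0 < h₀ ∧ ∀ h t, 0 ≤ h → h ≤ h₀ → 0 ≤ t → t + h ^ 2 ≤ T →
      ∀ (u : ℝ → ℝ) (K : ℝ), IsTestFunction u → EulerBound u K →
      |(∫ v, u v * f (t + h ^ 2) v) - ∫ v, observableStep σ lam h u v * f t v| ≤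
        C * h ^ 3 * K := by
  obtain ⟨M, hM0, hM⟩ := hf.exists_integral_abs_le
  obtain ⟨C₁, h₁, hC₁, hh₁, H₁⟩ := exists_abs_observableStep_sub_le hσ hlam
  obtain ⟨C₂, hC₂, H₂⟩ := exists_abs_adjointOperator_adjointOperator_le σ lam
  refine ⟨(C₁ + C₂) * M, min h₁ 1, by positivity, by positivity,
    fun h t hh0 hh ht htT u K hu hK => ?_⟩
  have hhle : h ≤ 1 := hh.trans (min_le_right _ _)
  have hK0 := hK.nonneg
  have hA := hu.adjointOperator σ lam
  have hh2 : 0 ≤ h ^ 2 := sq_nonneg h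
  have htm : t ∈ Icc 0 T := ⟨ht, by linarith⟩
  have htm' : t + h ^ 2 ∈ Icc 0 T := ⟨by linarith, htT⟩
  set P : ℝ → ℝ := fun s => ∫ v, adjointOperator σ lam u v * f s v with hP
  have hlip : ∀ s ∈ Icc t (t + h ^ 2), |P s - P t| ≤ C₂ * K * M * h ^ 2 := by
    intro s hs
    have hsm : s ∈ Icc 0 T := ⟨ht.trans hs.1, hs.2.trans htT⟩
    simp only [hP]
    rw [hf.integral_sub_eq hA htm hsm]
    have h1 : ‖∫ τ in t..s, ∫ v, adjointOperator σ lam (adjointOperator σ lam u) v * f τ v‖ ≤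
        C₂ * K * M * |s - t| := by
      refine intervalIntegral.norm_integral_le_of_norm_le_const fun τ hτ => ?_
      rw [uIoc_of_le hs.1] at hτ
      have hτm : τ ∈ Icc 0 T := ⟨ht.trans hτ.1.le, hτ.2.trans hsm.2⟩
      exact abs_integral_mul_le_of_abs_le (hM τ hτm).1 (by positivity) (H₂ u K hu hK) (hM τ hτm).2
    refine h1.trans ?_
    rw [abs_of_nonneg (by linarith [hs.1])]
    gcongr
    linarith [hs.2]
  have hinc : |(∫ v, u v * f (t + h ^ 2) v) - (∫ v, u v * f t v) - h ^ 2 * P t| ≤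
      C₂ * K * M * h ^ 2 * h ^ 2 := by
    have e : (∫ v, u v * f (t + h ^ 2) v) - (∫ v, u v * f t v) - h ^ 2 * P t =
        ∫ s in t..(t + h ^ 2), (P s - P t) := by
      rw [hf.integral_sub_eq hu htm htm', intervalIntegral.integral_sub
        (hf.intervalIntegrable_pairing hA htm htm') intervalIntegrable_const,
        intervalIntegral.integral_const]
      simp
    rw [e]
    have h1 : ‖∫ s in t..(t + h ^ 2), (P s - P t)‖ ≤
        C₂ * K * M * h ^ 2 * |t + h ^ 2 - t| := by
      refine intervalIntegral.norm_integral_le_of_norm_le_const fun s hs => ?_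
      rw [uIoc_of_le (by linarith)] at hs
      exact hlip s ⟨hs.1.le, hs.2⟩
    rwa [add_sub_cancel_left, abs_of_nonneg hh2] at h1
  have hcons : |∫ v, (observableStep σ lam h u v - u v - h ^ 2 * adjointOperator σ lam u v) *
      f t v| ≤ C₁ * h ^ 3 * K * M :=
    abs_integral_mul_le_of_abs_le (hM t htm).1 (by positivity)
      (H₁ h hh0 (hh.trans (min_le_left _ _)) u K hu hK) (hM t htm).2
  have hsplit : ∫ v, (observableStep σ lam h u v - u v - h ^ 2 * adjointOperator σ lam u v) *
      f t v = (∫ v, observableStep σ lam h u v * f t v) - (∫ v, u v * f t v) - h ^ 2 * P t := by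
    have i1 := (hu.observableStep σ lam h).integrable_mul (hM t htm).1
    have i2 := hu.integrable_mul (hM t htm).1
    have i3 := hA.integrable_mul (hM t htm).1
    have i12 : Integrable fun v => observableStep σ lam h u v * f t v - u v * f t v := i1.sub i2
    rw [hP, ← integral_const_mul, ← integral_sub i1 i2, ← integral_sub i12 (i3.const_mul _)]
    congr 1
    ext v
    ring
  rw [hsplit] at hcons
  have h4 : h ^ 2 * h ^ 2 ≤ h ^ 3 := by
    calc h ^ 2 * h ^ 2 = h ^ 3 * h := by ring
      _ ≤ h ^ 3 := mul_le_of_le_one_right (by positivity) hhle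
  have h5 : C₂ * K * M * (h ^ 2 * h ^ 2) ≤ C₂ * K * M * h ^ 3 := by gcongr
  rw [abs_le] at hinc hcons ⊢
  constructor <;> linarith [hinc.1, hinc.2, hcons.1, hcons.2]

/-- Stability and consistency of the discretization: the local errors `O(h³)` add up, and
the observable keeps its bounds, up to a factor `exp (c j h²)`, along `j` steps. -/
theorem IsSolution.exists_abs_integral_sub_densityStep_iterate_le {σ lam T : ℝ} (hσ : 0 ≤ σ)
    (hlam : 0 ≤ lam) {f₀ : ℝ → ℝ} (hf₀ : IsProbabilityDensity f₀) {f : ℝ → ℝ → ℝ}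
    (hf : IsSolution σ lam T f₀ f) :
    ∃ C h₀, 0 ≤ C ∧ 0 < h₀ ∧ ∀ h, 0 ≤ h → h ≤ h₀ → ∀ j : ℕ, j * h ^ 2 ≤ T →
      ∀ (u : ℝ → ℝ) (K : ℝ), IsTestFunction u → EulerBound u K →
      |(∫ v, u v * f (j * h ^ 2) v) - ∫ v, u v * (densityStep σ lam h)^[j] f₀ v| ≤
        j * (C * h ^ 3) * (Real.exp ((6 * σ + 4 * lam) * (j * h ^ 2)) * K) := by
  obtain ⟨C, h₀, hC, hh₀, H⟩ := hf.exists_abs_integral_sub_observableStep_le hσ hlam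
  refine ⟨C, h₀, hC, hh₀, fun h hh0 hh j => ?_⟩
  induction j with
  | zero =>
    intro hT u K hu hK
    rw [Nat.cast_zero, zero_mul] at hT
    simp [hf.integral_zero_eq hT hu]
  | succ j ih =>
    intro hT u K hu hK
    have hK0 := hK.nonneg
    have hsplit : ((j + 1 : ℕ) : ℝ) * h ^ 2 = j * h ^ 2 + h ^ 2 := by push_cast; ring
    rw [hsplit] at hT ⊢
    have hj0 : (0 : ℝ) ≤ j * h ^ 2 := by positivity
    have h1 := H h (j * h ^ 2) hh0 hh hj0 hT u K hu hK
    have h2 := ih (by linarith [sq_nonneg h]) _ _ (hu.observableStep σ lam h)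
      (hK.observableStep hσ hlam h hu)
    obtain ⟨B, hB⟩ := hu.exists_abs_le
    have hg := (hf₀.densityStep_iterate σ lam h j).integrable
    rw [Function.iterate_succ_apply', integral_mul_densityStep σ lam h hg hu.1.continuous hB]
    set E := Real.exp ((6 * σ + 4 * lam) * (j * h ^ 2 + h ^ 2)) with hE
    have hE' : Real.exp ((6 * σ + 4 * lam) * (j * h ^ 2)) *
        (Real.exp ((6 * σ + 4 * lam) * h ^ 2) * K) = E * K := by
      rw [← mul_assoc, ← Real.exp_add, hE, mul_add]
    rw [hE'] at h2
    have hE1 : 1 ≤ E := Real.one_le_exp (by positivity)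
    have h3 : C * h ^ 3 * K ≤ C * h ^ 3 * (E * K) := by
      gcongr
      exact le_mul_of_one_le_left hK0 hE1
    calc _ ≤ _ := abs_sub_le _ (∫ v, observableStep σ lam h u v * f (j * h ^ 2) v) _
      _ ≤ C * h ^ 3 * (E * K) + j * (C * h ^ 3) * (E * K) := add_le_add (h1.trans h3) h2
      _ = _ := by push_cast; ring

/-- The density at time `t` of the random affine recursion with `n + 1` equal time steps. -/
def approxDensity (σ lam : ℝ) (f₀ : ℝ → ℝ) (t : ℝ) (n : ℕ) : ℝ → ℝ :=
  (densityStep σ lam √(t / (n + 1)))^[n + 1] f₀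

theorem tendsto_sqrt_div_add_one (t : ℝ) :
    Filter.Tendsto (fun n : ℕ => √(t / (n + 1))) Filter.atTop (nhds 0) := by
  have h := (tendsto_one_div_add_atTop_nhds_zero_nat (𝕜 := ℝ)).const_mul t
  rw [mul_zero] at h
  have h' := (Real.continuous_sqrt.tendsto 0).comp h
  rw [Real.sqrt_zero] at h'
  refine h'.congr fun n => ?_
  simp [div_eq_mul_inv]

theorem add_one_mul_sqrt_div_sq {t : ℝ} (ht : 0 ≤ t) (n : ℕ) :
    ((n + 1 : ℕ) : ℝ) * √(t / (n + 1)) ^ 2 = t := by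
  rw [Real.sq_sqrt (by positivity)]
  push_cast
  field_simp

theorem IsSolution.tendsto_integral_approxDensity {σ lam T : ℝ} (hσ : 0 ≤ σ)
    (hlam : 0 ≤ lam) {f₀ : ℝ → ℝ} (hf₀ : IsProbabilityDensity f₀) {f : ℝ → ℝ → ℝ}
    (hf : IsSolution σ lam T f₀ f) {t : ℝ} (ht : t ∈ Icc 0 T) {u : ℝ → ℝ}
    (hu : IsTestFunction u) :
    Filter.Tendsto (fun n => ∫ v, u v * approxDensity σ lam f₀ t n v) Filter.atTop
      (nhds (∫ v, u v * f t v)) := by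
  obtain ⟨C, h₀, hC, hh₀, H⟩ := hf.exists_abs_integral_sub_densityStep_iterate_le hσ hlam hf₀
  obtain ⟨K, hK⟩ := hu.exists_eulerBound
  have hlim := tendsto_sqrt_div_add_one t
  have hlim2 : Filter.Tendsto (fun n : ℕ => t * C * (Real.exp ((6 * σ + 4 * lam) * t) * K) *
      √(t / (n + 1))) Filter.atTop (nhds 0) := by
    simpa using hlim.const_mul (t * C * (Real.exp ((6 * σ + 4 * lam) * t) * K))
  rw [tendsto_iff_dist_tendsto_zero]
  refine squeeze_zero' (Filter.Eventually.of_forall fun _ => dist_nonneg) ?_ hlim2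
  filter_upwards [hlim.eventually_le_const hh₀] with n hn
  have h1 := H _ (Real.sqrt_nonneg _) hn (n + 1)
  rw [add_one_mul_sqrt_div_sq ht.1] at h1
  have h2 := h1 ht.2 u K hu hK
  rw [dist_comm, Real.dist_eq]
  refine h2.trans_eq ?_
  linear_combination C * (Real.exp ((6 * σ + 4 * lam) * t) * K) * √(t / (n + 1)) *
    add_one_mul_sqrt_div_sq ht.1 n

/-! ### Smooth cutoffs and conservation of mass -/

/-- Smooth cutoffs that exhaust the line. The scale-invariant bounds do not see the dilation, hence
are uniform along the sequence. -/
theorem exists_cutoff : ∃ (χ : ℕ → ℝ → ℝ) (K : ℝ),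
    (∀ n, IsTestFunction (χ n)) ∧ (∀ n, EulerBound (χ n) K) ∧ (∀ n v, χ n v ∈ Icc 0 1) ∧
      ∀ (n : ℕ) v, |v| < (n : ℝ) + 1 → χ n v = 1 := by
  let b : ContDiffBump (0 : ℝ) := ⟨1, 2, one_pos, one_lt_two⟩
  have hb : IsTestFunction b := ⟨b.contDiff, b.hasCompactSupport⟩
  obtain ⟨K, hK⟩ := hb.exists_eulerBound
  have hpos : ∀ n : ℕ, (0 : ℝ) < ((n : ℝ) + 1)⁻¹ := fun n => by positivity
  refine ⟨fun n v => b (((n : ℝ) + 1)⁻¹ * v + 0), K, fun n => hb.comp_affine (hpos n).ne' 0,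
    fun n k hk v => ?_, fun n v => ⟨b.nonneg, b.le_one⟩, fun n v hv => ?_⟩
  · have hle : ((n : ℝ) + 1)⁻¹ ≤ 1 :=
      inv_le_one_of_one_le₀ (by linarith [Nat.cast_nonneg (α := ℝ) n])
    rw [hb.iteratedDeriv_comp_affine, abs_mul, abs_pow, abs_of_pos (hpos n)]
    constructor
    · exact (mul_le_of_le_one_left (abs_nonneg _) (pow_le_one₀ (hpos n).le hle)).trans (hK k hk _).1
    · have h := (hK k hk (((n : ℝ) + 1)⁻¹ * v + 0)).2
      rw [add_zero, abs_mul, abs_of_pos (hpos n), mul_pow] at h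
      rw [add_zero]
      linarith
  · refine b.one_of_mem_closedBall ?_
    rw [add_zero, mem_closedBall_zero_iff, Real.norm_eq_abs, abs_mul, abs_of_pos (hpos n),
      inv_mul_le_iff₀ (by positivity)]
    show |v| ≤ (n + 1) * 1
    linarith

theorem adjointOperator_eq_zero_of_eventuallyEq_const {σ lam : ℝ} {u : ℝ → ℝ} {c v : ℝ}
    (h : u =ᶠ[nhds v] fun _ => c) : adjointOperator σ lam u v = 0 := by
  have h1 : deriv u =ᶠ[nhds v] fun _ => 0 := by
    simpa using h.deriv
  have h2 : deriv (deriv u) v = 0 := by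
    simpa using h1.deriv_eq
  rw [adjointOperator, h2, h1.eq_of_nhds]
  ring

theorem eventually_abs_lt_natCast_add_one (v : ℝ) :
    ∀ᶠ n : ℕ in Filter.atTop, |v| < n + 1 := by
  filter_upwards [Filter.eventually_ge_atTop ⌈|v|⌉₊] with n hn
  have : |v| ≤ n := (Nat.le_ceil _).trans (by exact_mod_cast hn)
  linarith

theorem tendsto_integral_mul_of_eventually_eq {χ : ℕ → ℝ → ℝ} {g : ℝ → ℝ} {c K : ℝ}
    (hχ : ∀ n, Continuous (χ n)) (hK : ∀ n v, |χ n v| ≤ K)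
    (hlim : ∀ v, ∀ᶠ n in Filter.atTop, χ n v = c) (hg : Integrable g) :
    Filter.Tendsto (fun n => ∫ v, χ n v * g v) Filter.atTop (nhds (c * ∫ v, g v)) := by
  rw [← integral_const_mul]
  refine tendsto_integral_of_dominated_convergence (fun v => K * |g v|)
    (fun n => (hχ n).aestronglyMeasurable.mul hg.1) (hg.abs.const_mul K) (fun n => ?_) ?_
  · refine Filter.Eventually.of_forall fun v => ?_
    rw [norm_mul]
    exact mul_le_mul_of_nonneg_right (hK n v) (abs_nonneg _)
  · refine Filter.Eventually.of_forall fun v => ?_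
    refine tendsto_const_nhds.congr' ?_
    filter_upwards [hlim v] with n hn
    rw [hn]

/-- Conservation of mass: the adjoint operator applied to the cutoffs is bounded and tends to `0`
pointwise. -/
theorem IsSolution.integral_eq_one {σ lam T : ℝ} (hσ : 0 ≤ σ) (hlam : 0 ≤ lam)
    {f₀ : ℝ → ℝ} (hf₀ : IsProbabilityDensity f₀) {f : ℝ → ℝ → ℝ}
    (hf : IsSolution σ lam T f₀ f) {t : ℝ} (ht : t ∈ Icc 0 T) : ∫ v, f t v = 1 := by
  obtain ⟨χ, K, hχ, hK, h01, hone⟩ := exists_cutoff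
  obtain ⟨M, hM0, hM⟩ := hf.exists_integral_abs_le
  have h0 : (0 : ℝ) ∈ Icc 0 T := ⟨le_rfl, ht.1.trans ht.2⟩
  have hχ1 : ∀ n v, |χ n v| ≤ 1 := fun n v => abs_le.2 ⟨by linarith [(h01 n v).1], (h01 n v).2⟩
  have hev : ∀ v, ∀ᶠ n in Filter.atTop, χ n v = 1 := fun v =>
    (eventually_abs_lt_natCast_add_one v).mono fun n hn => hone n v hn
  have hAev : ∀ v, ∀ᶠ n in Filter.atTop, adjointOperator σ lam (χ n) v = 0 := by
    intro v
    refine (eventually_abs_lt_natCast_add_one v).mono fun n hn => ?_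
    refine adjointOperator_eq_zero_of_eventuallyEq_const (c := 1) ?_
    filter_upwards [continuous_abs.continuousAt.eventually_lt continuousAt_const hn] with w hw
    exact hone n w hw
  have hKn : 0 ≤ K := (hK 0).nonneg
  have hint : Filter.Tendsto
      (fun n => ∫ s in (0 : ℝ)..t, ∫ v, adjointOperator σ lam (χ n) v * f s v)
      Filter.atTop (nhds (∫ _ in (0 : ℝ)..t, (0 : ℝ))) := by
    refine intervalIntegral.tendsto_integral_filter_of_dominated_convergence
      (fun _ => (σ + 2 * lam) * K * M) ?_ ?_ intervalIntegrable_const ?_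
    · refine Filter.Eventually.of_forall fun n => ?_
      exact (hf.intervalIntegrable_pairing ((hχ n).adjointOperator σ lam) h0 ht).def'.1
    · refine Filter.Eventually.of_forall fun n => Filter.Eventually.of_forall fun s hs => ?_
      rw [uIoc_of_le ht.1] at hs
      have hsm : s ∈ Icc 0 T := ⟨hs.1.le, hs.2.trans ht.2⟩
      exact abs_integral_mul_le_of_abs_le (hM s hsm).1 (by positivity)
        ((hK n).abs_adjointOperator_le hσ hlam) (hM s hsm).2
    · refine Filter.Eventually.of_forall fun s hs => ?_
      rw [uIoc_of_le ht.1] at hs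
      have hsm : s ∈ Icc 0 T := ⟨hs.1.le, hs.2.trans ht.2⟩
      have := tendsto_integral_mul_of_eventually_eq (c := 0)
        (fun n => ((hχ n).adjointOperator σ lam).1.continuous)
        (fun n => (hK n).abs_adjointOperator_le hσ hlam) hAev (hM s hsm).1
      simpa using this
  have hL := tendsto_integral_mul_of_eventually_eq (fun n => (hχ n).1.continuous) hχ1 hev
    (hM t ht).1
  have hR := tendsto_integral_mul_of_eventually_eq (fun n => (hχ n).1.continuous) hχ1 hev
    hf₀.integrable
  have hS := hR.add hint
  simp_rw [hf.weak_form _ (hχ _) t ht] at hL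
  have := tendsto_nhds_unique hL hS
  simpa [hf₀.integral_eq_one] using this

/-! ### Pointwise convergence of the Fourier transforms -/

theorem integral_cexp_mul_eq {u g : ℝ → ℝ} (hu : IsTestFunction u) (hg : Integrable g) (ξ : ℝ) :
    ∫ v : ℝ, Complex.exp (-(Complex.I * (ξ : ℂ) * (v : ℂ))) * ((u v * g v : ℝ) : ℂ) =
      ((∫ v, (Real.cos (ξ * v) * u v) * g v : ℝ) : ℂ) -
        Complex.I * ((∫ v, (Real.sin (ξ * v) * u v) * g v : ℝ) : ℂ) := by
  have hc : IsTestFunction fun v => Real.cos (ξ * v) * u v :=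
    hu.mul_left (w := fun v => Real.cos (ξ * v)) (by fun_prop)
  have hs : IsTestFunction fun v => Real.sin (ξ * v) * u v :=
    hu.mul_left (w := fun v => Real.sin (ξ * v)) (by fun_prop)
  rw [← integral_complex_ofReal, ← integral_complex_ofReal, ← integral_const_mul,
    ← integral_sub (hc.integrable_mul hg).ofReal ((hs.integrable_mul hg).ofReal.const_mul _)]
  congr 1
  ext v
  have e : -(Complex.I * (ξ : ℂ) * (v : ℂ)) = ((-(ξ * v) : ℝ) : ℂ) * Complex.I := by
    push_cast; ring
  rw [e, Complex.exp_mul_I, ← Complex.ofReal_cos, ← Complex.ofReal_sin, Real.cos_neg, Real.sin_neg]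
  push_cast
  ring

theorem norm_fourierHat_sub_le {u g : ℝ → ℝ} (hu : IsTestFunction u) (h01 : ∀ v, u v ∈ Icc 0 1)
    (hg : Integrable g) (ξ : ℝ) :
    ‖fourierHat g ξ - ∫ v : ℝ, Complex.exp (-(Complex.I * (ξ : ℂ) * (v : ℂ))) *
      ((u v * g v : ℝ) : ℂ)‖ ≤ ∫ v, (1 - u v) * |g v| := by
  have hexp : Continuous fun v : ℝ => Complex.exp (-(Complex.I * (ξ : ℂ) * (v : ℂ))) := by
    fun_prop
  have hb : ∀ᵐ v : ℝ, ‖Complex.exp (-(Complex.I * (ξ : ℂ) * (v : ℂ)))‖ ≤ 1 :=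
    Filter.Eventually.of_forall fun v => (norm_cexp_neg_I_mul ξ v).le
  have i1 : Integrable fun v : ℝ =>
      Complex.exp (-(Complex.I * (ξ : ℂ) * (v : ℂ))) * (g v : ℂ) :=
    hg.ofReal.bdd_mul hexp.aestronglyMeasurable hb
  have i2 : Integrable fun v : ℝ =>
      Complex.exp (-(Complex.I * (ξ : ℂ) * (v : ℂ))) * ((u v * g v : ℝ) : ℂ) :=
    (hu.integrable_mul hg).ofReal.bdd_mul hexp.aestronglyMeasurable hb
  have i3 : Integrable fun v => (1 - u v) * |g v| := by
    have := hg.abs.sub (hu.integrable_mul hg.abs)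
    refine this.congr (Filter.Eventually.of_forall fun v => ?_)
    simp only [Pi.sub_apply]
    ring
  unfold fourierHat
  rw [← integral_sub i1 i2]
  refine norm_integral_le_of_norm_le i3 (Filter.Eventually.of_forall fun v => ?_)
  have e : Complex.exp (-(Complex.I * (ξ : ℂ) * (v : ℂ))) * (g v : ℂ) -
      Complex.exp (-(Complex.I * (ξ : ℂ) * (v : ℂ))) * ((u v * g v : ℝ) : ℂ) =
      Complex.exp (-(Complex.I * (ξ : ℂ) * (v : ℂ))) * (((1 - u v) * g v : ℝ) : ℂ) := by
    push_cast; ring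
  show ‖_ - _‖ ≤ _
  rw [e, norm_mul, norm_cexp_neg_I_mul, one_mul, Complex.norm_real, Real.norm_eq_abs, abs_mul,
    abs_of_nonneg (by linarith [(h01 v).2])]

/-- Vague convergence of probability densities without loss of mass implies pointwise convergence
of the Fourier transforms. -/
theorem tendsto_fourierHat_of_tendsto_integral {g : ℕ → ℝ → ℝ} {G : ℝ → ℝ}
    (hg : ∀ n, IsProbabilityDensity (g n)) (hG : Integrable G) (hG1 : ∫ v, G v = 1)
    (hlim : ∀ u, IsTestFunction u → Filter.Tendsto (fun n => ∫ v, u v * g n v) Filter.atTop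
      (nhds (∫ v, u v * G v))) (ξ : ℝ) :
    Filter.Tendsto (fun n => fourierHat (g n) ξ) Filter.atTop (nhds (fourierHat G ξ)) := by
  obtain ⟨χ, -, hχ, -, h01, hone⟩ := exists_cutoff
  have hχ1 : ∀ n v, |χ n v| ≤ 1 := fun n v => abs_le.2 ⟨by linarith [(h01 n v).1], (h01 n v).2⟩
  have hev : ∀ v, ∀ᶠ n in Filter.atTop, χ n v = 1 := fun v =>
    (eventually_abs_lt_natCast_add_one v).mono fun n hn => hone n v hn
  have split : ∀ m (k : ℝ → ℝ), Integrable k →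
      ∫ v, (1 - χ m v) * k v = (∫ v, k v) - ∫ v, χ m v * k v := by
    intro m k hk
    rw [← integral_sub hk ((hχ m).integrable_mul hk)]
    congr 1
    ext v
    ring
  have htail : Filter.Tendsto (fun m => ∫ v, (1 - χ m v) * |G v|) Filter.atTop (nhds 0) := by
    have h := (tendsto_integral_mul_of_eventually_eq (fun n => (hχ n).1.continuous) hχ1 hev
      hG.abs).const_sub (∫ v, |G v|)
    rw [one_mul, sub_self] at h
    exact h.congr fun m => (split m _ hG.abs).symm
  rw [Metric.tendsto_atTop']
  intro ε hε
  obtain ⟨m, hm⟩ := (htail.eventually_lt_const (show 0 < ε / 4 by positivity)).exists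
  set S : (ℝ → ℝ) → ℂ := fun k =>
    ∫ v : ℝ, Complex.exp (-(Complex.I * (ξ : ℂ) * (v : ℂ))) * ((χ m v * k v : ℝ) : ℂ) with hS
  have hSlim : Filter.Tendsto (fun n => S (g n)) Filter.atTop (nhds (S G)) := by
    have hc := hlim _ ((hχ m).mul_left (w := fun v => Real.cos (ξ * v)) (by fun_prop))
    have hs := hlim _ ((hχ m).mul_left (w := fun v => Real.sin (ξ * v)) (by fun_prop))
    have h := ((Complex.continuous_ofReal.tendsto _).comp hc).sub
      (((Complex.continuous_ofReal.tendsto _).comp hs).const_mul Complex.I)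
    simp only [hS]
    rw [integral_cexp_mul_eq (hχ m) hG]
    refine h.congr fun n => ?_
    rw [integral_cexp_mul_eq (hχ m) (hg n).integrable]
    rfl
  -- The mass that the approximations put outside the cutoff converges to that of the limit.
  have hmass : Filter.Tendsto (fun n => ∫ v, (1 - χ m v) * |g n v|) Filter.atTop
      (nhds (∫ v, (1 - χ m v) * G v)) := by
    have h := (hlim _ (hχ m)).const_sub 1
    rw [show 1 - ∫ v, χ m v * G v = ∫ v, (1 - χ m v) * G v by rw [split m G hG, hG1]] at h
    refine h.congr fun n => ?_
    rw [show 1 - ∫ v, χ m v * g n v = ∫ v, (1 - χ m v) * g n v by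
      rw [split m _ (hg n).integrable, (hg n).integral_eq_one]]
    refine integral_congr_ae ?_
    filter_upwards [(hg n).nonneg] with v hv
    rw [abs_of_nonneg hv]
  have hGm : ∫ v, (1 - χ m v) * G v < ε / 4 := by
    refine lt_of_le_of_lt ?_ hm
    rw [split m _ hG, split m _ hG.abs, ← integral_sub hG ((hχ m).integrable_mul hG),
      ← integral_sub hG.abs ((hχ m).integrable_mul hG.abs)]
    refine integral_mono (hG.sub ((hχ m).integrable_mul hG))
      (hG.abs.sub ((hχ m).integrable_mul hG.abs)) fun v => ?_
    have h1 : 0 ≤ 1 - χ m v := by linarith [(h01 m v).2]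
    have h2 := mul_le_mul_of_nonneg_left (le_abs_self (G v)) h1
    show G v - χ m v * G v ≤ |G v| - χ m v * |G v|
    linarith
  have hev1 := hmass.eventually_lt_const hGm
  have hev2 := (Metric.tendsto_nhds.1 hSlim) (ε / 4) (by positivity)
  obtain ⟨N, hN⟩ := Filter.eventually_atTop.1 (hev1.and hev2)
  refine ⟨N, fun n hn => ?_⟩
  obtain ⟨h1, h2⟩ := hN n hn.le
  have h3 := norm_fourierHat_sub_le (hχ m) (h01 m) (hg n).integrable ξ
  have h4 := norm_fourierHat_sub_le (hχ m) (h01 m) hG ξ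
  rw [← dist_eq_norm] at h3 h4
  have t1 := dist_triangle (fourierHat (g n) ξ) (S (g n)) (fourierHat G ξ)
  have t2 := dist_triangle (S (g n)) (S G) (fourierHat G ξ)
  rw [dist_comm (S G)] at t2
  linarith

/-! ### Passage to the limit in the Sobolev functional -/

theorem sobolevNorm_le_of_tendsto_fourierHat {r : ℝ} {g : ℕ → ℝ → ℝ} {G : ℝ → ℝ} {B : ℝ≥0∞}
    (hg : ∀ n, Integrable (g n))
    (hlim : ∀ ξ, Filter.Tendsto (fun n => fourierHat (g n) ξ) Filter.atTop (nhds (fourierHat G ξ)))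
    (hB : ∀ n, sobolevNorm r (g n) ≤ B) : sobolevNorm r G ≤ B := by
  have hmeas : ∀ n, Measurable fun ξ : ℝ =>
      ENNReal.ofReal (|ξ| ^ (2 * r) * ‖fourierHat (g n) ξ‖ ^ 2) := by
    intro n
    have : Measurable fun ξ => ‖fourierHat (g n) ξ‖ := (continuous_fourierHat (hg n)).norm.measurable
    fun_prop
  have hpt : ∀ ξ : ℝ, Filter.liminf (fun n =>
      ENNReal.ofReal (|ξ| ^ (2 * r) * ‖fourierHat (g n) ξ‖ ^ 2)) Filter.atTop =
      ENNReal.ofReal (|ξ| ^ (2 * r) * ‖fourierHat G ξ‖ ^ 2) := fun ξ =>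
    (ENNReal.tendsto_ofReal (((hlim ξ).norm.pow 2).const_mul _)).liminf_eq
  calc sobolevNorm r G = ∫⁻ ξ : ℝ, Filter.liminf (fun n =>
        ENNReal.ofReal (|ξ| ^ (2 * r) * ‖fourierHat (g n) ξ‖ ^ 2)) Filter.atTop := by
        simp_rw [hpt]; rfl
    _ ≤ Filter.liminf (fun n => sobolevNorm r (g n)) Filter.atTop := lintegral_liminf_le hmeas
    _ ≤ Filter.liminf (fun _ : ℕ => B) Filter.atTop :=
        Filter.liminf_le_liminf (Filter.Eventually.of_forall hB)
    _ = B := Filter.liminf_const B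

end WealthFP

end

theorem theorem2p3 (σ lam T r : ℝ) (hσ : 0 < σ) (hlam : 0 < lam) (hT : 0 < T)
    (f₀ : ℝ → ℝ) (hf₀ : WealthFP.IsProbabilityDensity f₀) (hr : WealthFP.MemSobolev r f₀)
    (f : ℝ → ℝ → ℝ) (hf : WealthFP.IsSolution σ lam T f₀ f) :
    ∀ t ∈ Set.Icc 0 T,
      WealthFP.MemSobolev r (f t) ∧
      WealthFP.sobolevNorm r (f t) ≤
        ENNReal.ofReal
            (Real.exp ((2 * r + 1) / 2 * (σ * ((2 * r + 3) / 2) + 2 * lam) * t)) *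
          WealthFP.sobolevNorm r f₀ := by
  intro t ht
  obtain ⟨M, -, hM⟩ := hf.exists_integral_abs_le
  have hint := (hM t ht).1
  have hdens : ∀ n, WealthFP.IsProbabilityDensity (WealthFP.approxDensity σ lam f₀ t n) :=
    fun n => hf₀.densityStep_iterate σ lam _ (n + 1)
  have hstep : ∀ n, WealthFP.sobolevNorm r (WealthFP.approxDensity σ lam f₀ t n) ≤
      ENNReal.ofReal
          (Real.exp ((2 * r + 1) / 2 * (σ * ((2 * r + 3) / 2) + 2 * lam) * t)) *
        WealthFP.sobolevNorm r f₀ := by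
    intro n
    have h := WealthFP.sobolevNorm_densityStep_iterate_le hσ.le lam √(t / (n + 1)) r hf₀ (n + 1)
    rwa [WealthFP.add_one_mul_sqrt_div_sq ht.1] at h
  have hbound := WealthFP.sobolevNorm_le_of_tendsto_fourierHat
    (fun n => (hdens n).integrable)
    (WealthFP.tendsto_fourierHat_of_tendsto_integral hdens hint
      (hf.integral_eq_one hσ.le hlam.le hf₀ ht)
      (fun u hu => hf.tendsto_integral_approxDensity hσ.le hlam.le hf₀ ht hu))
    hstep
  exact ⟨⟨hint, hbound.trans_lt (ENNReal.mul_lt_top ENNReal.ofReal_lt_top hr.2)⟩, hbound⟩
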